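/- Let $n\ge 1$. For positive integers $i_1,\dots,i_n$ consider ribbon graphs with $n$ vertices labelled $1,\dots,n$, where vertex $j$ has $i_j$ half-edges numbered $1,\dots,i_j$ in their cyclic order around the vertex; such a graph is given by a fixed-point-free involution (the pairing of half-edges into edges) on the set of all $i_1+\cdots+i_n$ half-edges. Its faces are the cycles of the permutation that sends a half-edge to its partner and then to the next half-edge in the cyclic order at the vertex of the partner, and the genus $g$ of a connected ribbon graph is defined by $V-E+F=2-2g$. Let $\mathrm{rg}_g(i_1,\dots,i_n)$ be the weighted number of connected ribbon graphs of genus $g$ with exactly one face and $n$ vertices of valencies $i_1,\dots,i_n$, that is, $\frac{1}{n!}$ times the number of labelled ribbon graphs as above that are connected, of genus $g$ and have exactly one face (a non-zero number forces $i_1+\cdots+i_n=4g+2n-2$). Put $$\mathcal G^{\mathrm{rg}}_{i_1,\dots,i_n}(g)=\frac{n!}{2\,(4g+2n-5)!!}\,\mathrm{rg}_g(i_1,\dots,i_n),\qquad (-1)!!=1 .$$ Theorem. For fixed $n\ge 1$ and fixed integers $i_1,\dots,i_{n-1}\ge 1$, put $|i|=i_1+\cdots+i_{n-1}$. There exists a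 rational function $R^{\mathrm{rg}}(g;i_1,\dots,i_{n-1})$ of $g$ with rational coefficients, which may depend on $n,i_1,\dots,i_{n-1}$, such that for every integer $g\ge 0$ with $4g+2n-2-|i|\ge 1$ the function $R^{\mathrm{rg}}$ has no pole at $g$ and $$\mathcal G^{\mathrm{rg}}_{i_1,\dots,i_{n-1},\,4g+2n-2-|i|}(g)=R^{\mathrm{rg}}(g;i_1,\dots,i_{n-1}).$$ -/

import Mathlib

open scoped Nat

/-- A ribbon graph with half-edge set `H`: the cycles of `rot` are the vertices (each with the
cyclic order of its half-edges), and the fixed-point-free involution `edge` glues the half-edges in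
pairs to edges. -/
structure RibbonGraph (H : Type*) where
  rot : Equiv.Perm H
  edge : Equiv.Perm H
  edge_edge : ∀ h, edge (edge h) = h
  edge_ne : ∀ h, edge h ≠ h

namespace RibbonGraph

variable {H : Type*}

/-- The number of cycles of a permutation, fixed points included. -/
noncomputable def numCycles (p : Equiv.Perm H) : ℕ :=
  Nat.card (Quotient (Equiv.Perm.SameCycle.setoid p))

noncomputable def numVertices (Γ : RibbonGraph H) : ℕ := numCycles Γ.rot

noncomputable def numEdges (Γ : RibbonGraph H) : ℕ := numCycles Γ.edge

/-- The faces (boundary components) are traced out by crossing an edge and then turning to the next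
half-edge at the vertex reached. -/
noncomputable def numFaces (Γ : RibbonGraph H) : ℕ := numCycles (Γ.rot * Γ.edge)

def Connected (Γ : RibbonGraph H) : Prop :=
  Nonempty H ∧ ∀ x y : H, ∃ p ∈ Subgroup.closure {Γ.rot, Γ.edge}, p x = y

/-- `Γ` has genus `g`, by Euler's formula `V - E + F = 2 - 2 g` (for connected `Γ`). -/
def HasGenus (Γ : RibbonGraph H) (g : ℕ) : Prop :=
  (Γ.numVertices : ℤ) - Γ.numEdges + Γ.numFaces = 2 - 2 * g

instance [Finite H] : Finite (RibbonGraph H) := by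
  refine Finite.of_injective (fun Γ : RibbonGraph H => (Γ.rot, Γ.edge)) ?_
  rintro ⟨r, e, _, _⟩ ⟨r', e', _, _⟩ h
  simp only [Prod.mk.injEq] at h
  obtain ⟨rfl, rfl⟩ := h
  rfl

end RibbonGraph

/-- The half-edges of `n` labelled vertices of valencies `i 0, …, i (n - 1)`; the half-edges at
vertex `j` are numbered by `Fin (i j)`. -/
abbrev HalfEdge {n : ℕ} (i : Fin n → ℕ) : Type := Σ j : Fin n, Fin (i j)

/-- The cyclic rotation of the half-edges around each vertex, in the order of their numbers. -/
def vertexRotation {n : ℕ} (i : Fin n → ℕ) : Equiv.Perm (HalfEdge i) :=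
  Equiv.sigmaCongrRight fun j => finRotate (i j)

/-- The weighted number `rg_g(i_1, …, i_n)` of connected ribbon graphs of genus `g` with one face
and `n` vertices of (positive) valencies `i_1, …, i_n`: the graphs with numbered vertices (vertex
`j` having valency `i_j`) and numbered half-edges are counted, and the `n!` numberings of the
vertices are divided out. With this weight, `n! * rg_g(i_1, …, i_n)` is the coefficient of `N` in
the connected GUE correlator of `tr M^{i_1}, …, tr M^{i_n}`. -/
noncomputable def rg {n : ℕ} (g : ℕ) (i : Fin n → ℕ) : ℚ :=
  (Nat.card {Γ : RibbonGraph (HalfEdge i) //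
    Γ.rot = vertexRotation i ∧ Γ.Connected ∧ Γ.HasGenus g ∧ Γ.numFaces = 1} : ℚ) / (n ! : ℚ)

/-- The normalized number `n! / (2 * (4g+2n-5)!!) * rg_g(i_1, …, i_n)`. For `n = 2`, `g = 0` the
truncated subtraction gives `0‼ = 1`, which is the usual value of `(-1)!!`; for `n ≥ 1` the only
smaller argument of the double factorial occurs at `n = 1`, `g = 0`, where the single vertex would
have valency `0`. -/
noncomputable def normalizedRG {n : ℕ} (g : ℕ) (i : Fin n → ℕ) : ℚ :=
  (n ! : ℚ) / (2 * ((4 * g + 2 * n - 5)‼ : ℚ)) * rg g i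

/-- The tuple `(i_1, …, i_{n-1}, d)` of length `n` (for `n ≥ 1`). -/
def appendLast {n : ℕ} (i : Fin (n - 1) → ℕ) (d : ℕ) : Fin n → ℕ :=
  fun j => if h : (j : ℕ) < n - 1 then i ⟨j, h⟩ else d

/-! A one-face graph is a pairing `e` of the half-edges for which `p * e` is a single cycle, where
`p` is the vertex rotation; connectedness is then automatic and Euler's formula gives the genus
(`RibbonGraph.card_oneFace`).

Weight each invariant set of a permutation by `-1` per cycle in it. Over the sets avoiding a base
point `h` the weights add up to `(1 - 1) ^ (c - 1)`, with `c` the number of cycles, so the sum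
detects transitivity (`sum_cycleWeight`). Now exchange this sum with the sum over `e`. For fixed
`S`, a sign-reversing involution cancels all pairings with two or more edges leaving `S`
(`sum_cycleWeight_of_one_lt_card`). With no leaving edge `S` must be a union of whole vertices; with
one, a union of whole vertices and one arc at a further vertex. Each contribution is a signed
matching count inside times a plain matching count outside (`card_pairings_vertexRotation`).

Place `h` at the last vertex, the only one whose valency grows with `g`. The only sum of unbounded
length runs over the arcs at that vertex, and it telescopes (`matchPrimitive_succ`,
`sum_arcs_matchSum`). In every remaining product one factor is independent of `g`, and the other,
unless it vanishes, is up to sign a double factorial at bounded distance from `(4g+2n-5)!!`, so the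
quotient is rational in `g`. The sign depends only on `n`, because there are `2g + n - 1` edges
(`rationalOn_matchSum_ratio`). -/

/-! ### Perfect matchings and their signed count -/

section Pairings

open Equiv Equiv.Perm Finset

/-- Fixed-point-free involutions. -/
def IsPairing {α : Type*} (e : Perm α) : Prop := (∀ x, e (e x) = x) ∧ ∀ x, e x ≠ x

open Classical in
/-- The set of all fixed-point-free involutions of a finite type. -/
noncomputable def pairings (α : Type*) [Fintype α] : Finset (Perm α) :=
  univ.filter IsPairing

theorem mem_pairings {α : Type*} [Fintype α] {e : Perm α} : e ∈ pairings α ↔ IsPairing e := by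
  simp [pairings]

/-- The sum of `ε ^ (number of pairs)` over all perfect matchings of a set of size `k`. -/
def matchSum (ε : ℤ) : ℕ → ℤ
  | 0 => 1
  | 1 => 0
  | k + 2 => ε * (k + 1) * matchSum ε k

/-- Deleting the pair `{s, t}` leaves an arbitrary pairing of the other elements. This gives the
recursion for matching counts and later isolates a single edge leaving a set. -/
theorem sum_pairings_of_apply_eq {α M : Type*} [Fintype α] [DecidableEq α] [AddCommMonoid M]
    {s t : α} (hst : s ≠ t) (F : Perm α → M) :
    ∑ e ∈ pairings α with e s = t, F e =
      ∑ e ∈ pairings {x : α // x ≠ s ∧ x ≠ t}, F (swap s t * ofSubtype e) := by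
  symm
  refine Finset.sum_of_injOn (fun e => swap s t * ofSubtype e) ?_ ?_ ?_ ?_
  · intro a _ b _ hab
    exact ofSubtype_injective (mul_left_cancel hab)
  · intro e he
    rw [mem_coe, mem_pairings] at he
    have hs : ofSubtype e s = s := ofSubtype_apply_of_not_mem e (by simp)
    have ht : ofSubtype e t = t := ofSubtype_apply_of_not_mem e (by simp)
    have hx : ∀ x (hx : x ≠ s ∧ x ≠ t), ofSubtype e x = e ⟨x, hx⟩ := fun x hx =>
      ofSubtype_apply_of_mem e hx
    simp only [coe_filter, Set.mem_ofPred_eq, mem_pairings, Perm.mul_apply, hs, swap_apply_left,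
      and_true]
    have key : ∀ x (h : x ≠ s ∧ x ≠ t), swap s t (ofSubtype e x) = e ⟨x, h⟩ := by
      intro x h
      rw [hx x h]
      exact swap_apply_of_ne_of_ne (e ⟨x, h⟩).2.1 (e ⟨x, h⟩).2.2
    constructor
    · intro x
      simp only [Perm.mul_apply]
      by_cases h1 : x = s
      · subst h1; simp [hs, ht]
      by_cases h2 : x = t
      · subst h2; simp [hs, ht]
      rw [key x ⟨h1, h2⟩, key _ (e ⟨x, h1, h2⟩).2]
      simp [he.1]
    · intro x
      simp only [Perm.mul_apply]
      by_cases h1 : x = s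
      · subst h1; simpa [hs] using hst.symm
      by_cases h2 : x = t
      · subst h2; simpa [ht] using hst
      rw [key x ⟨h1, h2⟩]
      intro h
      exact he.2 ⟨x, h1, h2⟩ (Subtype.ext h)
  · intro e he hne
    exfalso
    apply hne
    rw [mem_filter, mem_pairings] at he
    obtain ⟨⟨hinv, hfix⟩, hes⟩ := he
    have het : e t = s := by rw [← hes, hinv]
    have hp : ∀ x, (e x ≠ s ∧ e x ≠ t) ↔ (x ≠ s ∧ x ≠ t) := by
      intro x
      constructor
      · rintro ⟨h1, h2⟩
        exact ⟨fun h => h2 (h ▸ hes), fun h => h1 (h ▸ het)⟩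
      · rintro ⟨h1, h2⟩
        exact ⟨fun h => h2 (by rw [← hinv x, h, hes]), fun h => h1 (by rw [← hinv x, h, het])⟩
    refine ⟨e.subtypePerm hp, ?_, ?_⟩
    · rw [mem_coe, mem_pairings]
      exact ⟨fun x => Subtype.ext (hinv x), fun x h => hfix x (congrArg Subtype.val h)⟩
    · ext x
      simp only [Perm.mul_apply]
      by_cases h1 : x = s
      · subst h1
        rw [ofSubtype_apply_of_not_mem _ (by simp)]; simp [hes]
      by_cases h2 : x = t
      · subst h2
        rw [ofSubtype_apply_of_not_mem _ (by simp)]; simp [het]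
      rw [ofSubtype_apply_of_mem _ ⟨h1, h2⟩]
      have := (hp x).2 ⟨h1, h2⟩
      simp [swap_apply_of_ne_of_ne this.1 this.2]
  · intros; rfl

theorem card_ne_ne {α : Type*} [Fintype α] [DecidableEq α] {s t : α} (hst : s ≠ t) :
    Fintype.card {x : α // x ≠ s ∧ x ≠ t} = Fintype.card α - 2 := by
  rw [Fintype.card_subtype, ← card_pair hst, ← card_compl]
  congr 1
  ext x
  simp

/-- The exponent treats the plain count (`a = 0`) and the signed count (`a = 1`) in one induction: a
fixed element has `k + 1` possible partners, and each transposition contributes `(-1) ^ a`. -/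
theorem sum_sign_pow_pairings (a : ℕ) : ∀ (k : ℕ) (α : Type*) [Fintype α] [DecidableEq α],
    Fintype.card α = k →
    ∑ e ∈ pairings α, (sign e : ℤ) ^ a = matchSum ((-1) ^ a) k := by
  intro k
  induction k using Nat.twoStepInduction with
  | zero =>
    intro α _ _ h
    have := Fintype.card_eq_zero_iff.1 h
    have : pairings α = {1} := by
      ext e
      simp only [mem_pairings, mem_singleton]
      exact ⟨fun _ => Subsingleton.elim _ _, fun _ => ⟨fun x => isEmptyElim x, fun x => isEmptyElim x⟩⟩
    simp [this, matchSum]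
  | one =>
    intro α _ _ h
    have := Fintype.card_le_one_iff_subsingleton.1 h.le
    have : pairings α = ∅ := by
      ext e
      simp only [mem_pairings, notMem_empty, iff_false]
      rintro ⟨_, h2⟩
      obtain ⟨x⟩ := Fintype.card_pos_iff.1 (h ▸ Nat.one_pos)
      exact h2 x (Subsingleton.elim _ _)
    simp [this, matchSum]
  | more k ih _ =>
    intro α _ _ h
    obtain ⟨s⟩ := Fintype.card_pos_iff.1 (h ▸ Nat.succ_pos _ : 0 < Fintype.card α)
    rw [← sum_fiberwise (pairings α) (fun e => e s)]
    have h0 : ∑ e ∈ pairings α with e s = s, (sign e : ℤ) ^ a = 0 := by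
      apply sum_eq_zero
      intro e he
      rw [mem_filter, mem_pairings] at he
      exact absurd he.2 (he.1.2 s)
    rw [← sum_erase univ (f := fun t => ∑ e ∈ pairings α with e s = t, (sign e : ℤ) ^ a) h0]
    have : ∀ t ∈ univ.erase s, ∑ e ∈ pairings α with e s = t, (sign e : ℤ) ^ a =
        (-1) ^ a * matchSum ((-1) ^ a) k := by
      intro t ht
      have hst : s ≠ t := (ne_of_mem_erase ht).symm
      rw [sum_pairings_of_apply_eq hst, ← ih {x : α // x ≠ s ∧ x ≠ t}
        (by rw [card_ne_ne hst, h]; rfl), mul_sum]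
      refine sum_congr rfl fun e _ => ?_
      rw [Perm.sign_mul, sign_swap hst, sign_ofSubtype]
      push_cast
      rw [mul_pow]
    rw [sum_congr rfl this, sum_const, card_erase_of_mem (mem_univ _), card_univ, h, matchSum]
    simp; ring

theorem card_pairings (α : Type*) [Fintype α] [DecidableEq α] :
    ((pairings α).card : ℤ) = matchSum 1 (Fintype.card α) := by
  simpa using sum_sign_pow_pairings 0 _ α rfl

theorem sum_sign_pairings (α : Type*) [Fintype α] [DecidableEq α] :
    ∑ e ∈ pairings α, (sign e : ℤ) = matchSum (-1) (Fintype.card α) := by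
  simpa using sum_sign_pow_pairings 1 _ α rfl

end Pairings

/-! ### Signed invariant sets detect transitivity -/

section CycleWeight

open Equiv Equiv.Perm Finset

theorem apply_mem_iff_of_mapsTo {H : Type*} {p : Perm H} {S : Finset H} (h : ∀ x ∈ S, p x ∈ S) (x : H) :
    p x ∈ S ↔ x ∈ S := by
  refine ⟨fun hx => ?_, h x⟩
  have : S.map p.toEmbedding = S := by
    apply eq_of_subset_of_card_le
    · intro y hy
      obtain ⟨z, hz, rfl⟩ := mem_map.1 hy
      exact h z hz
    · simp
  rw [← this, mem_map] at hx
  obtain ⟨z, hz, hzx⟩ := hx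
  rwa [← p.injective hzx]

theorem apply_mem_symmDiff_iff {H : Type*} [DecidableEq H] {p : Perm H} {S T : Finset H}
    (hT : ∀ x, p x ∈ T ↔ x ∈ T) :
    (∀ x, p x ∈ symmDiff S T ↔ x ∈ symmDiff S T) ↔ ∀ x, p x ∈ S ↔ x ∈ S := by
  refine forall_congr' fun x => ?_
  simp only [mem_symmDiff, hT x]
  tauto

theorem Equiv.Perm.SameCycle.mem_of_invariant {H : Type*} {p : Perm H} {S : Finset H}
    (h : ∀ x, p x ∈ S ↔ x ∈ S) {x y : H} (hxy : p.SameCycle x y) (hx : x ∈ S) : y ∈ S := by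
  obtain ⟨i, rfl⟩ := hxy
  have := ((p.subtypePerm h ^ i) ⟨x, hx⟩).2
  rwa [subtypePerm_zpow] at this

theorem Equiv.Perm.SameCycle.mem_iff_of_invariant {H : Type*} {p : Perm H} {S : Finset H}
    (h : ∀ x, p x ∈ S ↔ x ∈ S) {x y : H} (hxy : p.SameCycle x y) : x ∈ S ↔ y ∈ S :=
  ⟨hxy.mem_of_invariant h, hxy.symm.mem_of_invariant h⟩

variable {H : Type*} [Fintype H] [DecidableEq H]

/-- For a set `S` invariant under `p`, the product of a factor `-1` for every cycle of `p` in `S`;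
zero if `S` is not invariant. -/
noncomputable def cycleWeight (p : Perm H) (S : Finset H) : ℤ :=
  if h : ∀ x, p x ∈ S ↔ x ∈ S then (-1) ^ #S * (sign (p.subtypePerm h) : ℤ) else 0

theorem cycleWeight_of_invariant {p : Perm H} {S : Finset H} (h : ∀ x, p x ∈ S ↔ x ∈ S) :
    cycleWeight p S = (-1) ^ #S * (sign (p.subtypePerm h) : ℤ) := dif_pos h

theorem cycleWeight_of_mapsTo_false {p : Perm H} {S : Finset H} {x : H} (hx : x ∈ S)
    (h : p x ∉ S) : cycleWeight p S = 0 :=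
  dif_neg fun h' => h ((h' x).2 hx)

theorem apply_mem_of_cycleWeight_ne_zero {p : Perm H} {S : Finset H} (h : cycleWeight p S ≠ 0)
    (x : H) : p x ∈ S ↔ x ∈ S := by
  by_contra hx
  exact h (dif_neg fun h' => hx (h' x))

theorem cycleWeight_congr {p ψ : Perm H} {S : Finset H} (h : ∀ x ∈ S, p x = ψ x) :
    cycleWeight p S = cycleWeight ψ S := by
  by_cases hp : ∀ x ∈ S, p x ∈ S
  · have hψ : ∀ x ∈ S, ψ x ∈ S := fun x hx => h x hx ▸ hp x hx
    rw [cycleWeight_of_invariant (apply_mem_iff_of_mapsTo hp),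
      cycleWeight_of_invariant (apply_mem_iff_of_mapsTo hψ)]
    have : p.subtypePerm (apply_mem_iff_of_mapsTo hp) =
        ψ.subtypePerm (apply_mem_iff_of_mapsTo hψ) :=
      Perm.ext fun x => Subtype.ext (h x x.2)
    rw [this]
  · push Not at hp
    obtain ⟨x, hx, hx'⟩ := hp
    rw [cycleWeight_of_mapsTo_false hx hx', cycleWeight_of_mapsTo_false hx (h x hx ▸ hx')]

/-- The sign of the restriction of `p` to an invariant set `S`; zero if `S` is not invariant. -/
noncomputable def localSign (p : Perm H) (S : Finset H) : ℤ :=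
  if h : ∀ x, p x ∈ S ↔ x ∈ S then (sign (p.subtypePerm h) : ℤ) else 0

theorem localSign_of_invariant {p : Perm H} {S : Finset H} (h : ∀ x, p x ∈ S ↔ x ∈ S) :
    localSign p S = (sign (p.subtypePerm h) : ℤ) := dif_pos h

theorem localSign_swap {S : Finset H} {a b : H} (ha : a ∈ S) (hb : b ∈ S) (hab : a ≠ b) :
    localSign (swap a b) S = -1 := by
  have hsupp : ∀ x, swap a b x ≠ x → x ∈ S := by
    intro x hx
    by_contra hxS
    exact hx (swap_apply_of_ne_of_ne (fun h => hxS (h ▸ ha)) (fun h => hxS (h ▸ hb)))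
  have h : ∀ x ∈ S, swap a b x ∈ S := by
    intro x hx
    by_cases h : swap a b x = x
    · rwa [h]
    · exact hsupp _ (fun h' => h ((swap a b).injective h'))
  rw [localSign_of_invariant (apply_mem_iff_of_mapsTo h), ← sign_ofSubtype,
    ofSubtype_subtypePerm _ hsupp, sign_swap hab]
  simp

/-- Multiplicativity is the reason for defining the weight through `sign` and not through a number
of cycles: a factor preserving `S` can be peeled off. -/
theorem cycleWeight_mul (p : Perm H) {ρ : Perm H} {S : Finset H} (hρ : ∀ x, ρ x ∈ S ↔ x ∈ S) :
    cycleWeight (p * ρ) S = cycleWeight p S * localSign ρ S := by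
  rw [localSign_of_invariant hρ]
  by_cases hp : ∀ x, p x ∈ S ↔ x ∈ S
  · have h : ∀ x, (p * ρ) x ∈ S ↔ x ∈ S := fun x => (hp (ρ x)).trans (hρ x)
    rw [cycleWeight_of_invariant hp, cycleWeight_of_invariant h, ← subtypePerm_mul p ρ hp hρ,
      Perm.sign_mul]
    push_cast
    ring
  · have h : ¬ ∀ x, (p * ρ) x ∈ S ↔ x ∈ S := by
      intro h
      apply hp
      intro x
      have := (h (ρ⁻¹ x)).trans (hρ (ρ⁻¹ x)).symm
      simpa using this
    rw [cycleWeight, cycleWeight, dif_neg hp, dif_neg h, zero_mul]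

theorem sign_subtypePerm_union {p : Perm H} {S T : Finset H} (hST : Disjoint S T)
    (hS : ∀ x, p x ∈ S ↔ x ∈ S) (hT : ∀ x, p x ∈ T ↔ x ∈ T)
    (h : ∀ x, p x ∈ S ∪ T ↔ x ∈ S ∪ T) :
    sign (p.subtypePerm h) = sign (p.subtypePerm hS) * sign (p.subtypePerm hT) := by
  rw [← sign_ofSubtype (p.subtypePerm h), ← sign_ofSubtype (p.subtypePerm hS),
    ← sign_ofSubtype (p.subtypePerm hT), ← Perm.sign_mul]
  congr 1
  ext x
  rw [Perm.mul_apply]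
  by_cases h1 : x ∈ S
  · have h2 : x ∉ T := disjoint_left.1 hST h1
    rw [ofSubtype_apply_of_mem _ (mem_union_left T h1), ofSubtype_apply_of_not_mem _ h2,
      ofSubtype_apply_of_mem _ h1]
    rfl
  · by_cases h2 : x ∈ T
    · rw [ofSubtype_apply_of_mem _ (mem_union_right S h2), ofSubtype_apply_of_mem _ h2]
      simp only [subtypePerm_apply]
      rw [ofSubtype_apply_of_not_mem _ fun h3 => h1 ((hS x).1 h3)]
    · rw [ofSubtype_apply_of_not_mem _ (by simp [h1, h2]), ofSubtype_apply_of_not_mem _ h2,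
        ofSubtype_apply_of_not_mem _ h1]

theorem cycleWeight_union {p : Perm H} {S T : Finset H} (hST : Disjoint S T)
    (hS : ∀ x, p x ∈ S ↔ x ∈ S) (hT : ∀ x, p x ∈ T ↔ x ∈ T) :
    cycleWeight p (S ∪ T) = cycleWeight p S * cycleWeight p T := by
  have h : ∀ x, p x ∈ S ∪ T ↔ x ∈ S ∪ T := by simp [hS, hT]
  rw [cycleWeight_of_invariant h, cycleWeight_of_invariant hS, cycleWeight_of_invariant hT,
    sign_subtypePerm_union hST hS hT h, card_union_of_disjoint hST, pow_add]
  push_cast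
  ring

theorem cycleWeight_empty (p : Perm H) : cycleWeight p ∅ = 1 := by
  have : ∀ x, p x ∈ (∅ : Finset H) ↔ x ∈ (∅ : Finset H) := by simp
  rw [cycleWeight_of_invariant this, Subsingleton.elim (p.subtypePerm this) 1]
  simp

/-- A cycle of length `m` has sign `(-1) ^ (m - 1)`, to be multiplied by `(-1) ^ m`. Fixed points
are treated apart because `IsCycle` excludes them. -/
theorem cycleWeight_of_sameCycle {p : Perm H} {S : Finset H} (hne : S.Nonempty)
    (h : ∀ x, p x ∈ S ↔ x ∈ S) (hc : ∀ x ∈ S, ∀ y ∈ S, p.SameCycle x y) :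
    cycleWeight p S = -1 := by
  rw [cycleWeight_of_invariant h]
  rcases Nat.lt_or_eq_of_le (Nat.succ_le_of_lt hne.card_pos) with hlt | heq
  · obtain ⟨a, ha, b, hb, hab⟩ := one_lt_card.1 (Nat.succ_le_of_lt hlt)
    have hmove : ∀ x : {x // x ∈ S}, p.subtypePerm h x ≠ x := by
      intro x hx
      have hfix : p x = x := congrArg Subtype.val hx
      have key : ∀ y ∈ S, y = x := fun y hy =>
        ((hc x x.2 y hy).eq_of_left hfix).symm
      exact hab ((key a ha).trans (key b hb).symm)
    have hcyc : (p.subtypePerm h).IsCycle :=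
      ⟨⟨a, ha⟩, hmove _, fun y _ => sameCycle_subtypePerm.2 (hc a ha y y.2)⟩
    have hsupp : (p.subtypePerm h).support = univ := by
      ext x
      exact ⟨fun _ => mem_univ _, fun _ => mem_support.2 (hmove x)⟩
    rw [hcyc.sign, hsupp, card_univ, Fintype.card_coe]
    push_cast
    rw [mul_neg, ← pow_add, Even.neg_one_pow ⟨_, rfl⟩]
  · have h1 : #S = 1 := by omega
    obtain ⟨a, rfl⟩ := card_eq_one.1 h1
    have : p.subtypePerm h = 1 := Subsingleton.elim _ _
    rw [this]
    simp

theorem cycleWeight_filter_sameCycle (p : Perm H) (x : H) :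
    cycleWeight p (univ.filter (p.SameCycle x)) = -1 := by
  apply cycleWeight_of_sameCycle ⟨x, mem_filter.2 ⟨mem_univ _, SameCycle.refl p x⟩⟩
  · simp
  · intro y hy z hz
    exact (mem_filter.1 hy).2.symm.trans (mem_filter.1 hz).2

/-- A cycle lies wholly inside or wholly outside an invariant set, so toggling it changes the number
of cycles by one; a set that is not invariant stays so. -/
theorem cycleWeight_symmDiff_cycle (p : Perm H) (S : Finset H) (x : H) :
    cycleWeight p (symmDiff S (univ.filter (p.SameCycle x))) = -cycleWeight p S := by
  set C := univ.filter (p.SameCycle x) with hC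
  have hCinv : ∀ y, p y ∈ C ↔ y ∈ C := by simp [hC]
  by_cases hS : ∀ y, p y ∈ S ↔ y ∈ S
  · have key : ∀ T : Finset H, (∀ y, p y ∈ T ↔ y ∈ T) → Disjoint T C →
        cycleWeight p (T ∪ C) = -cycleWeight p T := by
      intro T hT hTC
      rw [cycleWeight_union hTC hT hCinv, hC, cycleWeight_filter_sameCycle, mul_neg_one]
    by_cases hx : x ∈ S
    · have hCS : C ⊆ S := by
        intro y hy
        exact (SameCycle.mem_iff_of_invariant hS (mem_filter.1 hy).2).1 hx
      have h1 : symmDiff S C = S \ C := by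
        rw [symmDiff_def, sup_eq_union, sdiff_eq_empty_iff_subset.2 hCS, union_empty]
      have h2 := key (S \ C) (by simp [hS, hCinv]) sdiff_disjoint
      rw [sdiff_union_of_subset hCS] at h2
      rw [h1, h2, neg_neg]
    · have hCS : Disjoint S C := by
        rw [disjoint_right]
        intro y hy hyS
        exact hx ((SameCycle.mem_iff_of_invariant hS (mem_filter.1 hy).2).2 hyS)
      have h1 : symmDiff S C = S ∪ C := by
        rw [Disjoint.symmDiff_eq_sup hCS, sup_eq_union]
      rw [h1, key S hS hCS]
  · rw [cycleWeight, cycleWeight, dif_neg hS, dif_neg (by rwa [apply_mem_symmDiff_iff hCinv]),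
      neg_zero]

/-- In the transitive case only the empty set survives. Otherwise, toggling a fixed cycle that
misses `h` matches sets of opposite weight. -/
theorem sum_cycleWeight (p : Perm H) (h : H) :
    ∑ S with h ∉ S, cycleWeight p S = if ∀ x, p.SameCycle h x then 1 else 0 := by
  split_ifs with htr
  · rw [sum_eq_single ∅, cycleWeight_empty]
    · intro S hS hne
      by_contra hw
      obtain ⟨x, hx⟩ := nonempty_iff_ne_empty.2 hne
      exact (mem_filter.1 hS).2
        ((SameCycle.mem_iff_of_invariant (apply_mem_of_cycleWeight_ne_zero hw) (htr x)).2 hx)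
    · simp
  · push Not at htr
    obtain ⟨x, hx⟩ := htr
    refine sum_involution (fun S _ => symmDiff S (univ.filter (p.SameCycle x))) ?_ ?_ ?_ ?_
    · intro S _
      rw [cycleWeight_symmDiff_cycle, add_neg_cancel]
    · intro S _ _ hS
      have : univ.filter (p.SameCycle x) = ∅ := by simpa using hS
      have hx : x ∈ univ.filter (p.SameCycle x) := mem_filter.2 ⟨mem_univ _, SameCycle.refl p x⟩
      simp [this] at hx
    · intro S hS
      have hx' : ¬ p.SameCycle x h := fun h' => hx h'.symm
      simpa [mem_symmDiff, hx'] using hS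
    · intro S _
      exact symmDiff_symmDiff_cancel_right _ _

end CycleWeight

/-! ### Sum over all pairings for a fixed set -/

section SumOverPairings

open Equiv Equiv.Perm Finset

theorem isPairing_subtypeCongr {H : Type*} {P : H → Prop} [DecidablePred P] {a : Perm {x // P x}}
    {b : Perm {x // ¬ P x}} (ha : IsPairing a) (hb : IsPairing b) :
    IsPairing (a.subtypeCongr b) := by
  constructor
  · intro x
    by_cases hx : P x
    · rw [subtypeCongr.left_apply _ _ hx, subtypeCongr.left_apply_subtype, ha.1]
    · rw [subtypeCongr.right_apply _ _ hx, subtypeCongr.right_apply_subtype, hb.1]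
  · intro x h
    by_cases hx : P x
    · rw [subtypeCongr.left_apply _ _ hx] at h
      exact ha.2 ⟨x, hx⟩ (Subtype.ext h)
    · rw [subtypeCongr.right_apply _ _ hx] at h
      exact hb.2 ⟨x, hx⟩ (Subtype.ext h)

variable {H : Type*} [Fintype H] [DecidableEq H]

/-- A pairing preserving `S` is a pairing of `S` together with one of the complement, and only the
first carries a sign. -/
theorem sum_localSign_pairings (S : Finset H) :
    ∑ e ∈ pairings H with ∀ x ∈ S, e x ∈ S, localSign e S =
      matchSum (-1) #S * matchSum 1 (Fintype.card H - #S) := by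
  have h1 : ∑ a ∈ pairings {x // x ∈ S}, (sign a : ℤ) = matchSum (-1) #S := by
    rw [sum_sign_pairings, Fintype.card_coe]
  have h2 : (∑ b ∈ pairings {x // x ∉ S}, 1 : ℤ) = matchSum 1 (Fintype.card H - #S) := by
    rw [sum_const, nsmul_one, card_pairings, Fintype.card_subtype_compl, Fintype.card_coe]
  rw [← h1, ← h2, sum_mul_sum, ← sum_product']
  symm
  refine Finset.sum_of_injOn (fun ab => ab.1.subtypeCongr ab.2) ?_ ?_ ?_ ?_
  · rintro ⟨a, b⟩ _ ⟨a', b'⟩ _ h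
    exact Equiv.Perm.subtypeCongrHom_injective (fun x => x ∈ S) h
  · rintro ⟨a, b⟩ hab
    rw [mem_coe, mem_product, mem_pairings, mem_pairings] at hab
    rw [mem_coe, mem_filter, mem_pairings]
    refine ⟨isPairing_subtypeCongr hab.1 hab.2, fun x hx => ?_⟩
    rw [subtypeCongr.left_apply _ _ hx]
    exact (a ⟨x, hx⟩).2
  · intro e he hne
    rw [mem_filter, mem_pairings] at he
    have hS := apply_mem_iff_of_mapsTo he.2
    refine absurd ⟨(e.subtypePerm hS, e.subtypePerm fun x => not_congr (hS x)), ?_, ?_⟩ hne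
    · rw [mem_coe, mem_product, mem_pairings, mem_pairings]
      exact ⟨⟨fun x => Subtype.ext (he.1.1 x), fun x h => he.1.2 x (congrArg Subtype.val h)⟩,
        ⟨fun x => Subtype.ext (he.1.1 x), fun x h => he.1.2 x (congrArg Subtype.val h)⟩⟩
    · ext x
      by_cases hx : x ∈ S
      · exact subtypeCongr.left_apply _ _ hx
      · exact subtypeCongr.right_apply _ _ hx
  · rintro ⟨a, b⟩ _
    have hS : ∀ x ∈ S, a.subtypeCongr b x ∈ S := fun x hx => by
      rw [subtypeCongr.left_apply _ _ hx]
      exact (a ⟨x, hx⟩).2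
    rw [localSign_of_invariant (apply_mem_iff_of_mapsTo hS), mul_one]
    congr 2
    ext x
    exact (subtypeCongr.left_apply _ _ x.2).symm

theorem localSign_ofSubtype {P : H → Prop} [DecidablePred P] (e : Perm {x // P x}) (S : Finset H)
    (hS : ∀ x, e x ∈ S.subtype P ↔ x ∈ S.subtype P) :
    localSign (ofSubtype e) S = localSign e (S.subtype P) := by
  have h : ∀ x ∈ S, ofSubtype e x ∈ S := by
    intro x hx
    by_cases hP : P x
    · rw [ofSubtype_apply_of_mem e hP]
      exact mem_subtype.1 ((hS ⟨x, hP⟩).2 (mem_subtype.2 hx))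
    · rwa [ofSubtype_apply_of_not_mem e hP]
  rw [localSign_of_invariant (apply_mem_iff_of_mapsTo h), localSign_of_invariant hS]
  congr 1
  symm
  refine sign_bij (fun x _ => ⟨x.1.1, mem_subtype.1 x.2⟩) ?_ ?_ ?_
  · intro x _ _
    apply Subtype.ext
    exact (ofSubtype_apply_of_mem e x.1.2).symm
  · intro x y _ _ hxy
    simp only [Subtype.mk.injEq] at hxy
    exact Subtype.ext (Subtype.ext hxy)
  · intro y hy
    have hP : P y := by
      by_contra hP
      exact hy (Subtype.ext (ofSubtype_apply_of_not_mem e hP))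
    refine ⟨⟨⟨y, hP⟩, mem_subtype.2 y.2⟩, fun hx => hy (Subtype.ext ?_), rfl⟩
    have := congrArg (fun z => (z.1.1 : H)) hx
    exact (ofSubtype_apply_of_mem e hP).trans this

theorem sum_cycleWeight_of_apply_eq (p : Perm H) {S : Finset H} {s t : H} (hs : s ∈ S)
    (ht : t ∉ S) :
    ∑ e ∈ pairings H with e s = t ∧ ∀ x ∈ S, x ≠ s → e x ∈ S, cycleWeight (p * e) S =
      cycleWeight (p * swap s t) S *
        (matchSum (-1) (#S - 1) * matchSum 1 (Fintype.card H - #S - 1)) := by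
  have hst : s ≠ t := fun h => ht (h ▸ hs)
  rw [← filter_filter, sum_filter, sum_pairings_of_apply_eq hst]
  set P : H → Prop := fun x => x ≠ s ∧ x ≠ t with hP
  have hcard : #(S.subtype P) = #S - 1 := by
    rw [card_subtype, ← card_erase_of_mem hs]
    congr 1
    ext x
    simp only [hP, mem_filter, mem_erase]
    exact ⟨fun h => ⟨h.2.1, h.1⟩, fun h => ⟨h.2, h.1, fun h' => ht (h' ▸ h.2)⟩⟩
  have hpos : 0 < #S := card_pos.2 ⟨s, hs⟩
  have := sum_localSign_pairings (S.subtype P)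
  rw [hcard, card_ne_ne hst] at this
  rw [show Fintype.card H - #S - 1 = Fintype.card H - 2 - (#S - 1) by omega, ← this, mul_sum,
    sum_filter]
  refine sum_congr rfl fun e _ => ?_
  have hsw : ∀ x (hx : P x), (swap s t * ofSubtype e) x = e ⟨x, hx⟩ := by
    intro x hx
    rw [Perm.mul_apply, ofSubtype_apply_of_mem e hx]
    exact swap_apply_of_ne_of_ne (e ⟨x, hx⟩).2.1 (e ⟨x, hx⟩).2.2
  have hiff : (∀ x ∈ S, x ≠ s → (swap s t * ofSubtype e) x ∈ S) ↔
      ∀ x ∈ S.subtype P, e x ∈ S.subtype P := by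
    constructor
    · intro h x hx
      have := h x (mem_subtype.1 hx) x.2.1
      rw [hsw x x.2] at this
      exact mem_subtype.2 this
    · intro h x hx hxs
      have hxP : P x := ⟨hxs, fun h' => ht (h' ▸ hx)⟩
      rw [hsw x hxP]
      exact mem_subtype.1 (h ⟨x, hxP⟩ (mem_subtype.2 hx))
  by_cases hc : ∀ x ∈ S.subtype P, e x ∈ S.subtype P
  · rw [if_pos hc, if_pos (hiff.2 hc), ← mul_assoc, cycleWeight_mul,
      localSign_ofSubtype e S (apply_mem_iff_of_mapsTo hc)]
    apply apply_mem_iff_of_mapsTo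
    intro x hx
    by_cases hxs : x = s
    · subst hxs
      rwa [ofSubtype_apply_of_not_mem _ (by simp)]
    · have hxP : P x := ⟨hxs, fun h' => ht (h' ▸ hx)⟩
      rw [ofSubtype_apply_of_mem _ hxP]
      exact mem_subtype.1 (hc ⟨x, hxP⟩ (mem_subtype.2 hx))
  · rw [if_neg hc, if_neg (fun h => hc (hiff.1 h))]

/-- Conjugate `e` by the transposition of two elements `a`, `b` of `S` whose partners lie outside
`S`. No element of `S` is a partner of `a` or `b`, so on `S` the conjugate agrees with `e * swap a
b`, and the weight changes sign. -/
theorem sum_cycleWeight_of_one_lt_card (p : Perm H) (S : Finset H) :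
    ∑ e ∈ pairings H with 1 < #{x ∈ S | e x ∉ S}, cycleWeight (p * e) S = 0 := by
  -- The transposition depends only on the set `X` of crossing elements, which the conjugation
  -- preserves; hence applying the map twice gives back `e`.
  have hpick : ∀ X : Finset H, ∃ w : Perm H,
      1 < #X → ∃ a ∈ X, ∃ b ∈ X, a ≠ b ∧ w = swap a b := by
    intro X
    by_cases hX : 1 < #X
    · obtain ⟨a, ha, b, hb, hab⟩ := one_lt_card.1 hX
      exact ⟨swap a b, fun _ => ⟨a, ha, b, hb, hab, rfl⟩⟩
    · exact ⟨1, fun h => absurd h hX⟩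
  choose w hw using hpick
  have hww : ∀ X, 1 < #X → ∀ x, w X (w X x) = x := by
    intro X hX x
    obtain ⟨a, _, b, _, _, h⟩ := hw X hX
    rw [h, swap_apply_self]
  have hwmem : ∀ X Y, 1 < #X → X ⊆ Y → ∀ x, w X x ∈ Y ↔ x ∈ Y := by
    intro X Y hX hXY
    obtain ⟨a, ha, b, hb, _, h⟩ := hw X hX
    apply apply_mem_iff_of_mapsTo
    intro x hx
    rw [h, swap_apply_def]
    split_ifs
    exacts [hXY hb, hXY ha, hx]
  have hcross : ∀ e X, X = {x ∈ S | e x ∉ S} → 1 < #X →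
      ({x ∈ S | (w X * e * w X) x ∉ S} : Finset H) = X := by
    intro e X hX h1
    have hXS : X ⊆ S := hX ▸ filter_subset _ _
    ext x
    refine Iff.trans ?_ (hwmem X X h1 subset_rfl x)
    refine Iff.trans ?_ (Finset.ext_iff.1 hX (w X x)).symm
    simp only [mem_filter, Perm.mul_apply, hwmem X S h1 hXS]
  have hneg : ∀ e, IsPairing e → 1 < #{x ∈ S | e x ∉ S} → cycleWeight (p * e) S +
      cycleWeight (p * (w {x ∈ S | e x ∉ S} * e * w {x ∈ S | e x ∉ S})) S = 0 := by
    rintro e ⟨hinv, -⟩ h1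
    set X : Finset H := {x ∈ S | e x ∉ S} with hX
    have hXS : X ⊆ S := filter_subset _ _
    have hcongr : ∀ x ∈ S, (p * (w X * e * w X)) x = (p * e * w X) x := by
      intro x hx
      simp only [Perm.mul_apply]
      congr 1
      have hy : w X x ∈ S := (hwmem X S h1 hXS x).2 hx
      obtain ⟨a, ha, b, hb, _, h⟩ := hw X h1
      have hne : ∀ c ∈ X, e (w X x) ≠ c := by
        intro c hc hec
        apply (mem_filter.1 hc).2
        rwa [← hec, hinv]
      nth_rewrite 1 [h]
      exact swap_apply_of_ne_of_ne (hne a ha) (hne b hb)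
    obtain ⟨a, ha, b, hb, hab, h⟩ := hw X h1
    rw [cycleWeight_congr hcongr, cycleWeight_mul _ (hwmem X S h1 hXS), h,
      localSign_swap (hXS ha) (hXS hb) hab]
    ring
  refine sum_involution
    (fun e _ => w {x ∈ S | e x ∉ S} * e * w {x ∈ S | e x ∉ S}) ?_ ?_ ?_ ?_
  · intro e he
    rw [mem_filter, mem_pairings] at he
    exact hneg e he.1 he.2
  · intro e he hne heq
    rw [mem_filter, mem_pairings] at he
    have := hneg e he.1 he.2
    rw [heq] at this
    omega
  · intro e he
    rw [mem_filter, mem_pairings] at he ⊢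
    obtain ⟨⟨hinv, hfix⟩, h1⟩ := he
    rw [hcross e _ rfl h1]
    refine ⟨⟨fun x => ?_, fun x hx => ?_⟩, h1⟩
    · simp only [Perm.mul_apply, hww _ h1, hinv]
    · apply hfix (w {x ∈ S | e x ∉ S} x)
      have := congrArg (w {x ∈ S | e x ∉ S}) hx
      rwa [Perm.mul_apply, Perm.mul_apply, hww _ h1] at this
  · intro e he
    have h1 := (mem_filter.1 he).2
    rw [hcross e _ rfl h1]
    ext x
    simp only [Perm.mul_apply, hww _ h1]

theorem sum_cycleWeight_pairings (p : Perm H) (S : Finset H) :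
    ∑ e ∈ pairings H, cycleWeight (p * e) S =
      cycleWeight p S * (matchSum (-1) #S * matchSum 1 (Fintype.card H - #S)) +
      ∑ s ∈ S, ∑ t ∈ Sᶜ, cycleWeight (p * swap s t) S *
        (matchSum (-1) (#S - 1) * matchSum 1 (Fintype.card H - #S - 1)) := by
  have h0 : cycleWeight p S * (matchSum (-1) #S * matchSum 1 (Fintype.card H - #S)) =
      ∑ e ∈ pairings H with ∀ x ∈ S, e x ∈ S, cycleWeight (p * e) S := by
    rw [← sum_localSign_pairings, mul_sum]
    refine sum_congr rfl fun e he => ?_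
    rw [cycleWeight_mul _ (apply_mem_iff_of_mapsTo (mem_filter.1 he).2)]
  have h1 : ∑ s ∈ S, ∑ t ∈ Sᶜ, cycleWeight (p * swap s t) S *
        (matchSum (-1) (#S - 1) * matchSum 1 (Fintype.card H - #S - 1)) =
      ∑ e ∈ pairings H, ∑ s ∈ S, ∑ t ∈ Sᶜ,
        if e s = t ∧ ∀ x ∈ S, x ≠ s → e x ∈ S then cycleWeight (p * e) S else 0 := by
    rw [sum_comm (s := pairings H)]
    refine sum_congr rfl fun s hs => ?_
    rw [sum_comm (s := pairings H)]
    refine sum_congr rfl fun t ht => ?_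
    rw [← sum_filter, sum_cycleWeight_of_apply_eq p hs (mem_compl.1 ht)]
  have h2 := sum_cycleWeight_of_one_lt_card p S
  rw [sum_filter] at h2
  rw [h0, h1, sum_filter]
  -- For each `e`, according to whether no, one or several elements of `S` cross, only the
  -- corresponding one of the three terms can be nonzero.
  refine Eq.trans (b := ∑ e ∈ pairings H, (((if ∀ x ∈ S, e x ∈ S then cycleWeight (p * e) S else 0) +
    ∑ s ∈ S, ∑ t ∈ Sᶜ,
      if e s = t ∧ ∀ x ∈ S, x ≠ s → e x ∈ S then cycleWeight (p * e) S else 0) +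
    if 1 < #{x ∈ S | e x ∉ S} then cycleWeight (p * e) S else 0)) ?_
    (by rw [sum_add_distrib, sum_add_distrib, h2, add_zero])
  refine sum_congr rfl fun e _ => ?_
  set X : Finset H := {x ∈ S | e x ∉ S} with hX
  have hXmem : ∀ x, x ∈ X ↔ x ∈ S ∧ e x ∉ S := fun x => mem_filter
  have hsum : ∀ s ∈ S, (∑ t ∈ Sᶜ,
      if e s = t ∧ ∀ x ∈ S, x ≠ s → e x ∈ S then cycleWeight (p * e) S else 0) =
      if X = {s} then cycleWeight (p * e) S else 0 := by
    intro s hs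
    have hcond : X = {s} ↔ e s ∉ S ∧ ∀ x ∈ S, x ≠ s → e x ∈ S := by
      rw [Finset.ext_iff]
      simp only [hXmem, mem_singleton]
      constructor
      · intro h
        refine ⟨((h s).2 rfl).2, fun x hx hxs => ?_⟩
        by_contra hex
        exact hxs ((h x).1 ⟨hx, hex⟩)
      · rintro ⟨h1, h2⟩ x
        refine ⟨fun h => ?_, fun h => h ▸ ⟨hs, h1⟩⟩
        by_contra hxs
        exact h.2 (h2 x h.1 hxs)
    simp only [ite_and, hcond, sum_ite_eq, mem_compl]
  rw [sum_congr rfl hsum]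
  rcases lt_trichotomy #X 1 with h | h | h
  · have hXe : X = ∅ := card_eq_zero.1 (by omega)
    have : ∀ x ∈ S, e x ∈ S := by
      intro x hx
      by_contra hex
      have := (hXmem x).2 ⟨hx, hex⟩
      simp [hXe] at this
    rw [if_pos this, if_neg (by omega), sum_eq_zero]
    · simp
    · intro s _
      rw [if_neg]
      intro hs
      simp [hXe] at hs
  · obtain ⟨a, ha⟩ := card_eq_one.1 h
    have haS := (hXmem a).1 (by simp [ha])
    rw [if_neg (fun h' => haS.2 (h' a haS.1)), if_neg (by omega), sum_eq_single a]
    · simp [ha]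
    · intro s _ hs
      rw [if_neg]
      rw [ha]
      simpa using hs.symm
    · exact fun h' => absurd haS.1 h'
  · obtain ⟨a, ha⟩ := card_pos.1 (by omega : 0 < #X)
    have haS := (hXmem a).1 ha
    rw [if_neg (fun h' => haS.2 (h' a haS.1)), if_pos h, sum_eq_zero]
    · simp
    · intro s _
      rw [if_neg]
      intro hs
      simp [hs] at h

/-- The number of fixed-point-free involutions `e` such that `p * e` is transitive, as a signed
sum over subsets avoiding a base point. -/
theorem card_pairings_transitive (p : Perm H) (h : H) :
    (#{e ∈ pairings H | ∀ x, (p * e).SameCycle h x} : ℤ) =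
      ∑ S with h ∉ S, (cycleWeight p S *
          (matchSum (-1) #S * matchSum 1 (Fintype.card H - #S)) +
        ∑ s ∈ S, ∑ t ∈ Sᶜ, cycleWeight (p * swap s t) S *
          (matchSum (-1) (#S - 1) * matchSum 1 (Fintype.card H - #S - 1))) := by
  rw [natCast_card_filter]
  simp only [← sum_cycleWeight_pairings, ← sum_cycleWeight]
  exact sum_comm

end SumOverPairings

/-! ### The vertex rotation and its invariant sets -/

section HalfEdges

open Equiv Equiv.Perm Finset

variable {n : ℕ} {i : Fin n → ℕ}

theorem HalfEdge.ext {x y : HalfEdge i} (h1 : x.1 = y.1) (h2 : (x.2 : ℕ) = y.2) : x = y := by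
  obtain ⟨j, a⟩ := x
  obtain ⟨j', b⟩ := y
  obtain rfl : j = j' := h1
  obtain rfl : a = b := Fin.ext h2
  rfl

theorem HalfEdge.valency_pos (x : HalfEdge i) : 0 < i x.1 := x.2.pos

theorem finRotate_val (m : ℕ) (a : Fin m) : (finRotate m a : ℕ) = (a + 1) % m := by
  cases m with
  | zero => exact a.elim0
  | succ m => rw [finRotate_apply, Fin.val_add, Fin.val_one', Nat.add_mod_mod]

theorem vertexRotation_fst (x : HalfEdge i) : (vertexRotation i x).1 = x.1 := rfl

theorem vertexRotation_pow_fst (k : ℕ) (x : HalfEdge i) : ((vertexRotation i ^ k) x).1 = x.1 := by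
  induction k with
  | zero => rfl
  | succ k ih => rw [pow_succ', Perm.mul_apply, vertexRotation_fst, ih]

theorem vertexRotation_snd (x : HalfEdge i) :
    ((vertexRotation i x).2 : ℕ) = (x.2 + 1) % i x.1 := finRotate_val _ _

theorem vertexRotation_pow_snd (k : ℕ) (x : HalfEdge i) :
    (((vertexRotation i ^ k) x).2 : ℕ) = (x.2 + k) % i x.1 := by
  induction k with
  | zero => exact (Nat.mod_eq_of_lt x.2.2).symm
  | succ k ih =>
    rw [pow_succ', Perm.mul_apply, vertexRotation_snd, ih, vertexRotation_pow_fst, Nat.mod_add_mod,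
      add_assoc]

theorem vertexRotation_pow_valency (x : HalfEdge i) : (vertexRotation i ^ i x.1) x = x := by
  apply HalfEdge.ext (vertexRotation_pow_fst _ _)
  rw [vertexRotation_pow_snd, Nat.add_mod_right, Nat.mod_eq_of_lt x.2.2]

/-- Exponents run from `1` to the valency, not from `0`, because arcs begin just after their
reference half-edge and a full turn ends at it. -/
theorem vertexRotation_pow_injOn (x : HalfEdge i) :
    Set.InjOn (fun k => (vertexRotation i ^ k) x) (Set.Icc 1 (i x.1)) := by
  intro a ha b hb hab
  have h : (x.2 + a) % i x.1 = (x.2 + b) % i x.1 := by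
    rw [← vertexRotation_pow_snd, ← vertexRotation_pow_snd]
    simp only at hab
    rw [hab]
  have h2 : a ≡ b [MOD i x.1] := Nat.ModEq.add_left_cancel' _ h
  rcases le_total a b with hle | hle
  · obtain ⟨c, hc⟩ := (Nat.modEq_iff_dvd' hle).1 h2
    rcases c with _ | c
    · omega
    · have : i x.1 ≤ b - a := hc ▸ Nat.le_mul_of_pos_right _ (Nat.succ_pos c)
      have := ha.1; have := hb.2
      omega
  · obtain ⟨c, hc⟩ := (Nat.modEq_iff_dvd' hle).1 h2.symm
    rcases c with _ | c
    · omega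
    · have : i x.1 ≤ a - b := hc ▸ Nat.le_mul_of_pos_right _ (Nat.succ_pos c)
      have := hb.1; have := ha.2
      omega

theorem exists_vertexRotation_pow_eq {x y : HalfEdge i} (h : y.1 = x.1) :
    ∃ k ∈ Set.Icc 1 (i x.1), (vertexRotation i ^ k) x = y := by
  have hx := x.2.2
  have hy : (y.2 : ℕ) < i x.1 := h ▸ y.2.2
  rcases lt_or_ge (x.2 : ℕ) y.2 with hlt | hge
  · refine ⟨y.2 - x.2, ⟨by omega, by omega⟩,
      HalfEdge.ext ((vertexRotation_pow_fst _ _).trans h.symm) ?_⟩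
    rw [vertexRotation_pow_snd, Nat.mod_eq_of_lt (by omega)]
    omega
  · refine ⟨y.2 + i x.1 - x.2, ⟨by omega, by omega⟩,
      HalfEdge.ext ((vertexRotation_pow_fst _ _).trans h.symm) ?_⟩
    rw [vertexRotation_pow_snd, show (x.2 + (y.2 + i x.1 - x.2) : ℕ) = y.2 + i x.1 by omega,
      Nat.add_mod_right, Nat.mod_eq_of_lt hy]

/-- The half-edges at the vertices in `C`. -/
def halfEdgesAt (i : Fin n → ℕ) (C : Finset (Fin n)) : Finset (HalfEdge i) :=
  univ.filter fun x => x.1 ∈ C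

theorem mem_halfEdgesAt {C : Finset (Fin n)} {x : HalfEdge i} :
    x ∈ halfEdgesAt i C ↔ x.1 ∈ C := by
  simp [halfEdgesAt]

theorem card_halfEdgesAt (i : Fin n → ℕ) (C : Finset (Fin n)) :
    #(halfEdgesAt i C) = ∑ j ∈ C, i j := by
  have : halfEdgesAt i C = C.sigma fun _ => univ := by
    ext x
    simp [mem_halfEdgesAt]
  rw [this, card_sigma]
  simp

theorem sameCycle_vertexRotation {x y : HalfEdge i} (h : y.1 = x.1) :
    (vertexRotation i).SameCycle x y := by
  obtain ⟨k, _, hk⟩ := exists_vertexRotation_pow_eq h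
  exact ⟨k, by rwa [zpow_natCast]⟩

theorem vertexRotation_mem_halfEdgesAt (C : Finset (Fin n)) (x : HalfEdge i) :
    vertexRotation i x ∈ halfEdgesAt i C ↔ x ∈ halfEdgesAt i C := by
  rw [mem_halfEdgesAt, mem_halfEdgesAt, vertexRotation_fst]

theorem cycleWeight_halfEdgesAt (hi : ∀ j, 1 ≤ i j) (C : Finset (Fin n)) :
    cycleWeight (vertexRotation i) (halfEdgesAt i C) = (-1) ^ #C := by
  induction C using Finset.induction_on with
  | empty =>
    have : halfEdgesAt i ∅ = ∅ := by ext x; simp [mem_halfEdgesAt]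
    rw [this, cycleWeight_empty, card_empty, pow_zero]
  | insert j C hj ih =>
    have h : halfEdgesAt i (insert j C) = halfEdgesAt i {j} ∪ halfEdgesAt i C := by
      ext x
      simp [mem_halfEdgesAt]
    have hd : Disjoint (halfEdgesAt i {j}) (halfEdgesAt i C) := by
      rw [disjoint_left]
      intro x hx hx'
      rw [mem_halfEdgesAt, mem_singleton] at hx
      rw [mem_halfEdgesAt, hx] at hx'
      exact hj hx'
    rw [h, cycleWeight_union hd (vertexRotation_mem_halfEdgesAt _)
      (vertexRotation_mem_halfEdgesAt _), ih, card_insert_of_notMem hj, pow_succ',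
      cycleWeight_of_sameCycle _ (vertexRotation_mem_halfEdgesAt _)]
    · intro x hx y hy
      rw [mem_halfEdgesAt, mem_singleton] at hx hy
      exact sameCycle_vertexRotation (hy.trans hx.symm)
    · exact ⟨⟨j, ⟨0, hi j⟩⟩, by simp [mem_halfEdgesAt]⟩

theorem halfEdgesAt_injective (hi : ∀ j, 1 ≤ i j) : Function.Injective (halfEdgesAt i) := by
  intro C C' h
  ext j
  simpa [mem_halfEdgesAt] using Finset.ext_iff.1 h ⟨j, ⟨0, hi j⟩⟩

/-- Each vertex is a single cycle, so the invariant sets are the unions of whole vertices. -/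
theorem sum_cycleWeight_vertexRotation (hi : ∀ j, 1 ≤ i j) (h : HalfEdge i) (g : ℕ → ℤ) :
    ∑ S with h ∉ S, cycleWeight (vertexRotation i) S * g #S =
      ∑ C ∈ (univ.erase h.1).powerset, (-1) ^ #C * g (∑ j ∈ C, i j) := by
  symm
  refine sum_of_injOn (halfEdgesAt i) (halfEdgesAt_injective hi).injOn ?_ ?_ ?_
  · intro C hC
    rw [mem_coe, mem_powerset] at hC
    rw [mem_coe, mem_filter, mem_halfEdgesAt]
    exact ⟨mem_univ _, fun hh => by simpa using hC hh⟩
  · intro S hS hne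
    by_contra hw
    have hinv := apply_mem_of_cycleWeight_ne_zero (left_ne_zero_of_mul hw)
    apply hne
    refine ⟨univ.filter fun j => (⟨j, ⟨0, hi j⟩⟩ : HalfEdge i) ∈ S, ?_, ?_⟩
    · rw [mem_coe, mem_powerset]
      intro j hj
      rw [mem_filter] at hj
      rw [mem_erase]
      refine ⟨?_, mem_univ _⟩
      rintro rfl
      exact (mem_filter.1 hS).2 ((sameCycle_vertexRotation (x := ⟨h.1, ⟨0, hi _⟩⟩) (y := h) rfl).mem_of_invariant hinv hj.2)
    · ext x
      rw [mem_halfEdgesAt, mem_filter]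
      simp only [mem_univ, true_and]
      exact SameCycle.mem_iff_of_invariant hinv (sameCycle_vertexRotation rfl)
  · intro C _
    rw [cycleWeight_halfEdgesAt hi, card_halfEdgesAt]

end HalfEdges

/-! ### One leaving edge: merging two vertices or cutting one into arcs -/

section Splitting

open Equiv Equiv.Perm Finset

variable {n : ℕ} {i : Fin n → ℕ}

/-- The `r` half-edges that follow `t` in the cyclic order at its vertex. -/
def cyclicInterval (t : HalfEdge i) (r : ℕ) : Finset (HalfEdge i) :=
  (Icc 1 r).image fun k => (vertexRotation i ^ k) t

theorem fst_of_mem_cyclicInterval {t x : HalfEdge i} {r : ℕ} (hx : x ∈ cyclicInterval t r) :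
    x.1 = t.1 := by
  obtain ⟨k, _, rfl⟩ := mem_image.1 hx
  exact vertexRotation_pow_fst _ _

theorem card_cyclicInterval {t : HalfEdge i} {r : ℕ} (hr : r ≤ i t.1) :
    #(cyclicInterval t r) = r := by
  rw [cyclicInterval, card_image_of_injOn]
  · simp
  · refine (vertexRotation_pow_injOn t).mono fun k hk => ?_
    have := mem_Icc.1 (mem_coe.1 hk)
    exact ⟨this.1, this.2.trans hr⟩

theorem pow_mem_cyclicInterval {t : HalfEdge i} {r k : ℕ} (hr : r ≤ i t.1) (hk1 : 1 ≤ k)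
    (hk : k ≤ i t.1) : (vertexRotation i ^ k) t ∈ cyclicInterval t r ↔ k ≤ r := by
  constructor
  · intro h
    obtain ⟨l, hl, hlk⟩ := mem_image.1 h
    rw [mem_Icc] at hl
    rw [← vertexRotation_pow_injOn t ⟨hl.1, hl.2.trans hr⟩ ⟨hk1, hk⟩ hlk]
    exact hl.2
  · exact fun h => mem_image_of_mem _ (mem_Icc.2 ⟨hk1, h⟩)

theorem rotation_swap_apply {s t : HalfEdge i} {k : ℕ} (hs : (vertexRotation i ^ k) t ≠ s)
    (ht : (vertexRotation i ^ k) t ≠ t) :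
    (vertexRotation i * swap s t) ((vertexRotation i ^ k) t) = (vertexRotation i ^ (k + 1)) t := by
  rw [Perm.mul_apply, swap_apply_of_ne_of_ne hs ht, pow_succ', Perm.mul_apply]

theorem rotation_swap_apply_left (s t : HalfEdge i) :
    (vertexRotation i * swap s t) s = (vertexRotation i ^ 1) t := by
  rw [Perm.mul_apply, swap_apply_left, pow_one]

theorem vertexRotation_pow_ne {t : HalfEdge i} {k l : ℕ} (hk1 : 1 ≤ k) (hk : k ≤ i t.1)
    (hl1 : 1 ≤ l) (hl : l ≤ i t.1) (hkl : k ≠ l) :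
    (vertexRotation i ^ k) t ≠ (vertexRotation i ^ l) t :=
  fun h => hkl (vertexRotation_pow_injOn t ⟨hk1, hk⟩ ⟨hl1, hl⟩ h)

theorem vertexRotation_pow_ne_self {t : HalfEdge i} {k : ℕ} (hk1 : 1 ≤ k) (hk : k < i t.1) :
    (vertexRotation i ^ k) t ≠ t := by
  have := vertexRotation_pow_ne hk1 hk.le t.valency_pos le_rfl hk.ne
  rwa [vertexRotation_pow_valency] at this

/-- The transposition merges the two vertices into one cycle: from `s` the path runs around the
vertex of `t` until it reaches `t`, so no invariant set separates them. -/
theorem cycleWeight_rotation_swap_of_fst_ne {s t : HalfEdge i} (hst : s.1 ≠ t.1)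
    {S : Finset (HalfEdge i)} (hs : s ∈ S) (ht : t ∉ S) :
    cycleWeight (vertexRotation i * swap s t) S = 0 := by
  by_contra hw
  have hinv := apply_mem_of_cycleWeight_ne_zero hw
  have key : ∀ k, 1 ≤ k → k ≤ i t.1 → (vertexRotation i ^ k) t ∈ S := by
    intro k hk1
    induction k, hk1 using Nat.le_induction with
    | base =>
      intro _
      rw [← rotation_swap_apply_left s t]
      exact (hinv s).2 hs
    | succ k hk1 ih =>
      intro hk
      rw [← rotation_swap_apply (s := s) _ (vertexRotation_pow_ne_self hk1 hk)]
      · exact (hinv _).2 (ih (by omega))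
      · intro h
        exact hst (h ▸ vertexRotation_pow_fst k t)
  have := key _ t.valency_pos le_rfl
  rw [vertexRotation_pow_valency] at this
  exact ht this

section SameVertex

variable {t : HalfEdge i} {r : ℕ} (hr1 : 1 ≤ r) (hr : r < i t.1)

include hr1 hr in
theorem rotation_swap_pow_of_ne {k : ℕ} (hk1 : 1 ≤ k) (hk : k < i t.1) (hkr : k ≠ r) :
    (vertexRotation i * swap ((vertexRotation i ^ r) t) t) ((vertexRotation i ^ k) t) =
      (vertexRotation i ^ (k + 1)) t :=
  rotation_swap_apply (vertexRotation_pow_ne hk1 hk.le hr1 hr.le hkr)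
    (vertexRotation_pow_ne_self hk1 hk)

include hr1 hr in
-- The transposition sends the end of the arc back to its start, so the arc closes up and is cut off
-- from the rest of the vertex.
theorem rotation_swap_mem_cyclicInterval (x : HalfEdge i) :
    (vertexRotation i * swap ((vertexRotation i ^ r) t) t) x ∈ cyclicInterval t r ↔
      x ∈ cyclicInterval t r := by
  refine apply_mem_iff_of_mapsTo (fun x hx => ?_) x
  obtain ⟨k, hk, rfl⟩ := mem_image.1 hx
  rw [mem_Icc] at hk
  by_cases hkr : k = r
  · subst hkr
    rw [rotation_swap_apply_left, pow_mem_cyclicInterval hr.le le_rfl (hk.1.trans hr.le)]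
    exact hk.1
  · rw [rotation_swap_pow_of_ne hr1 hr hk.1 (by omega) hkr,
      pow_mem_cyclicInterval hr.le (by omega) (by omega)]
    omega

include hr1 hr in
theorem cycleWeight_cyclicInterval :
    cycleWeight (vertexRotation i * swap ((vertexRotation i ^ r) t) t) (cyclicInterval t r) =
      -1 := by
  have key : ∀ k, 1 ≤ k → k ≤ r → (vertexRotation i * swap ((vertexRotation i ^ r) t) t).SameCycle
      ((vertexRotation i ^ 1) t) ((vertexRotation i ^ k) t) := by
    intro k hk1
    induction k, hk1 using Nat.le_induction with
    | base => exact fun _ => SameCycle.refl _ _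
    | succ k hk1 ih =>
      intro hk
      rw [← rotation_swap_pow_of_ne hr1 hr hk1 (by omega) (by omega), sameCycle_apply_right]
      exact ih (by omega)
  apply cycleWeight_of_sameCycle _ (rotation_swap_mem_cyclicInterval hr1 hr)
  · intro x hx y hy
    obtain ⟨k, hk, rfl⟩ := mem_image.1 hx
    obtain ⟨l, hl, rfl⟩ := mem_image.1 hy
    rw [mem_Icc] at hk hl
    exact (key k hk.1 hk.2).symm.trans (key l hl.1 hl.2)
  · exact card_pos.1 (by rw [card_cyclicInterval hr.le]; omega)

include hr1 hr in
theorem pow_mem_iff_of_rotation_swap_invariant {S : Finset (HalfEdge i)}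
    (hinv : ∀ x, (vertexRotation i * swap ((vertexRotation i ^ r) t) t) x ∈ S ↔ x ∈ S)
    (hs : (vertexRotation i ^ r) t ∈ S) (ht : t ∉ S) {k : ℕ} (hk1 : 1 ≤ k) (hk : k ≤ i t.1) :
    (vertexRotation i ^ k) t ∈ S ↔ k ≤ r := by
  have step : ∀ k, 1 ≤ k → k < i t.1 → k ≠ r →
      ((vertexRotation i ^ (k + 1)) t ∈ S ↔ (vertexRotation i ^ k) t ∈ S) := by
    intro k h1 h2 h3
    rw [← rotation_swap_pow_of_ne hr1 hr h1 h2 h3]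
    exact hinv _
  have up : ∀ k, 1 ≤ k → k ≤ r → (vertexRotation i ^ k) t ∈ S := by
    intro k hk1
    induction k, hk1 using Nat.le_induction with
    | base =>
      intro _
      rw [← rotation_swap_apply_left ((vertexRotation i ^ r) t) t]
      exact (hinv _).2 hs
    | succ k hk1 ih =>
      intro hk
      exact (step k hk1 (by omega) (by omega)).2 (ih (by omega))
  have down : ∀ k, r + 1 ≤ k → k ≤ i t.1 →
      ((vertexRotation i ^ k) t ∈ S ↔ (vertexRotation i ^ (r + 1)) t ∈ S) := by
    intro k hk1
    induction k, hk1 using Nat.le_induction with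
    | base => exact fun _ => Iff.rfl
    | succ k hk1 ih =>
      intro hk
      exact (step k (by omega) (by omega) (by omega)).trans (ih (by omega))
  refine ⟨fun h => ?_, up k hk1⟩
  by_contra hkr
  have h1 := (down k (by omega) hk).1 h
  have h2 := (down (i t.1) (by omega) le_rfl).2 h1
  rw [vertexRotation_pow_valency] at h2
  exact ht h2

theorem rotation_swap_apply_of_fst_ne (r : ℕ) {x : HalfEdge i} (hx : x.1 ≠ t.1) :
    (vertexRotation i * swap ((vertexRotation i ^ r) t) t) x = vertexRotation i x := by
  rw [Perm.mul_apply, swap_apply_of_ne_of_ne]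
  · rintro rfl
    exact hx (vertexRotation_pow_fst _ _)
  · rintro rfl
    exact hx rfl

include hr1 hr in
theorem cycleWeight_cyclicInterval_union (hi : ∀ j, 1 ≤ i j) {C : Finset (Fin n)} (hC : t.1 ∉ C) :
    cycleWeight (vertexRotation i * swap ((vertexRotation i ^ r) t) t)
      (cyclicInterval t r ∪ halfEdgesAt i C) = -(-1) ^ #C := by
  have hne : ∀ x ∈ halfEdgesAt i C, x.1 ≠ t.1 := by
    intro x hx h
    exact hC (h ▸ mem_halfEdgesAt.1 hx)
  have hd : Disjoint (cyclicInterval t r) (halfEdgesAt i C) :=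
    disjoint_left.2 fun x hx hx' => hne x hx' (fst_of_mem_cyclicInterval hx)
  have hcongr : ∀ x ∈ halfEdgesAt i C,
      (vertexRotation i * swap ((vertexRotation i ^ r) t) t) x = vertexRotation i x :=
    fun x hx => rotation_swap_apply_of_fst_ne r (hne x hx)
  rw [cycleWeight_union hd (rotation_swap_mem_cyclicInterval hr1 hr),
    cycleWeight_cyclicInterval hr1 hr, cycleWeight_congr hcongr, cycleWeight_halfEdgesAt hi,
    neg_one_mul]
  apply apply_mem_iff_of_mapsTo
  intro x hx
  rwa [hcongr x hx, vertexRotation_mem_halfEdgesAt]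

include hr1 hr in
-- An invariant `S` separating the two half-edges is this arc together with whole vertices other
-- than those of `t` and `h`. The arc is one more cycle, hence the extra sign; if `h` lies on it, no
-- `S` is admissible.
theorem sum_cycleWeight_rotation_swap (hi : ∀ j, 1 ≤ i j) (h : HalfEdge i) (g : ℕ → ℤ) :
    ∑ S with h ∉ S ∧ (vertexRotation i ^ r) t ∈ S ∧ t ∉ S,
        cycleWeight (vertexRotation i * swap ((vertexRotation i ^ r) t) t) S * g #S =
      if h ∈ cyclicInterval t r then 0 else
        ∑ C ∈ ((univ.erase h.1).erase t.1).powerset, -(-1) ^ #C * g (r + ∑ j ∈ C, i j) := by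
  have hmem : ∀ S : Finset (HalfEdge i), (vertexRotation i ^ r) t ∈ S → t ∉ S →
      (∀ x, (vertexRotation i * swap ((vertexRotation i ^ r) t) t) x ∈ S ↔ x ∈ S) →
      ∀ x, x.1 = t.1 → (x ∈ S ↔ x ∈ cyclicInterval t r) := by
    intro S hs ht hinv x hx
    obtain ⟨k, hk, rfl⟩ := exists_vertexRotation_pow_eq hx
    rw [pow_mem_iff_of_rotation_swap_invariant hr1 hr hinv hs ht hk.1 hk.2,
      pow_mem_cyclicInterval hr.le hk.1 hk.2]
  have hother : ∀ S : Finset (HalfEdge i),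
      (∀ x, (vertexRotation i * swap ((vertexRotation i ^ r) t) t) x ∈ S ↔ x ∈ S) →
      ∀ x y : HalfEdge i, x.1 ≠ t.1 → y.1 = x.1 → (y ∈ S ↔ x ∈ S) := by
    intro S hinv x y hx hy
    obtain ⟨k, -, rfl⟩ := exists_vertexRotation_pow_eq hy
    clear hy
    induction k with
    | zero => rfl
    | succ k ih =>
      rw [← ih, ← hinv ((vertexRotation i ^ k) x), rotation_swap_apply_of_fst_ne, pow_succ',
        Perm.mul_apply]
      rwa [vertexRotation_pow_fst]
  split_ifs with hP
  · refine sum_eq_zero fun S hS => ?_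
    by_contra hw
    have hinv := apply_mem_of_cycleWeight_ne_zero (left_ne_zero_of_mul hw)
    have hS := (mem_filter.1 hS).2
    exact hS.1 ((hmem S hS.2.1 hS.2.2 hinv h (fst_of_mem_cyclicInterval hP)).2 hP)
  · symm
    have htC : ∀ C ∈ ((univ.erase h.1).erase t.1).powerset, t.1 ∉ C ∧ h.1 ∉ C := by
      intro C hC
      rw [mem_powerset] at hC
      exact ⟨fun h' => by simpa using hC h', fun h' => by simpa using hC h'⟩
    have hunion : ∀ (C : Finset (Fin n)) (x : HalfEdge i), x.1 ≠ t.1 →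
        (x ∈ cyclicInterval t r ∪ halfEdgesAt i C ↔ x.1 ∈ C) := by
      intro C x hx
      rw [mem_union, mem_halfEdgesAt, or_iff_right]
      exact fun h' => hx (fst_of_mem_cyclicInterval h')
    refine sum_of_injOn (fun C => cyclicInterval t r ∪ halfEdgesAt i C) ?_ ?_ ?_ ?_
    · intro C hC C' hC' hCC
      ext j
      by_cases hj : j = t.1
      · subst hj
        simp [(htC C hC).1, (htC C' hC').1]
      · rw [← hunion C ⟨j, ⟨0, hi j⟩⟩ hj, ← hunion C' ⟨j, ⟨0, hi j⟩⟩ hj]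
        exact Finset.ext_iff.1 hCC _
    · intro C hC
      have := htC C hC
      rw [mem_coe, mem_filter]
      refine ⟨mem_univ _, ?_, ?_, ?_⟩
      · simp [mem_halfEdgesAt, hP, this.2]
      · rw [mem_union, pow_mem_cyclicInterval hr.le hr1 hr.le]
        exact Or.inl le_rfl
      · have h1 := pow_mem_cyclicInterval (t := t) hr.le t.valency_pos le_rfl
        rw [vertexRotation_pow_valency] at h1
        rw [mem_union, mem_halfEdgesAt, h1]
        rintro (h2 | h2)
        · omega
        · exact this.1 h2
    · intro S hS hne
      by_contra hw
      have hinv := apply_mem_of_cycleWeight_ne_zero (left_ne_zero_of_mul hw)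
      have hS := (mem_filter.1 hS).2
      apply hne
      refine ⟨univ.filter fun j => j ≠ t.1 ∧ (⟨j, ⟨0, hi j⟩⟩ : HalfEdge i) ∈ S, ?_, ?_⟩
      · rw [mem_coe, mem_powerset]
        intro j hj
        rw [mem_filter] at hj
        rw [mem_erase, mem_erase]
        refine ⟨hj.2.1, ?_, mem_univ _⟩
        rintro rfl
        exact hS.1 ((hother S hinv ⟨h.1, ⟨0, hi _⟩⟩ h hj.2.1 rfl).2 hj.2.2)
      · ext x
        by_cases hx : x.1 = t.1
        · simp only [mem_union, mem_halfEdgesAt, mem_filter, hx, ne_eq, not_true_eq_false,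
            false_and, and_false, or_false]
          exact (hmem S hS.2.1 hS.2.2 hinv x hx).symm
        · rw [hunion _ x hx, mem_filter]
          simp only [mem_univ, true_and, ne_eq, hx, not_false_eq_true]
          exact hother S hinv x _ hx rfl
    · intro C hC
      have := htC C hC
      have hd : Disjoint (cyclicInterval t r) (halfEdgesAt i C) :=
        disjoint_left.2 fun x hx hx' =>
          this.1 (fst_of_mem_cyclicInterval hx ▸ mem_halfEdgesAt.1 hx')
      rw [cycleWeight_cyclicInterval_union hr1 hr hi this.1, card_union_of_disjoint hd,
        card_cyclicInterval hr.le, card_halfEdgesAt]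

end SameVertex

end Splitting

/-! ### Counting the arcs that avoid the base point -/

section Counting

open Equiv Equiv.Perm Finset

variable {n : ℕ} {i : Fin n → ℕ}

theorem sum_rotation_swap (t : HalfEdge i) (hi : ∀ j, 1 ≤ i j) (h : HalfEdge i) (g : ℕ → ℤ) :
    ∑ s, ∑ S with h ∉ S ∧ s ∈ S ∧ t ∉ S, cycleWeight (vertexRotation i * swap s t) S * g #S =
      ∑ r ∈ Ico 1 (i t.1), if h ∈ cyclicInterval t r then 0 else
        ∑ C ∈ ((univ.erase h.1).erase t.1).powerset, -(-1) ^ #C * g (r + ∑ j ∈ C, i j) := by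
  symm
  refine sum_of_injOn (fun r => (vertexRotation i ^ r) t) ?_ (fun _ _ => mem_coe.2 (mem_univ _)) ?_ ?_
  · refine (vertexRotation_pow_injOn t).mono fun r hr => ?_
    rw [mem_coe, mem_Ico] at hr
    exact ⟨hr.1, hr.2.le⟩
  · intro s _ hne
    refine sum_eq_zero fun S hS => ?_
    have hS := (mem_filter.1 hS).2
    by_cases hst : s.1 = t.1
    · exfalso
      obtain ⟨k, hk, rfl⟩ := exists_vertexRotation_pow_eq hst
      rcases Nat.lt_or_eq_of_le hk.2 with hlt | rfl
      · exact hne ⟨k, by simpa using ⟨hk.1, hlt⟩, rfl⟩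
      -- A full turn would give `s = t`, which cannot be both in `S` and outside it.
      · rw [vertexRotation_pow_valency] at hS
        exact hS.2.2 hS.2.1
    · rw [cycleWeight_rotation_swap_of_fst_ne hst hS.2.1 hS.2.2, zero_mul]
  · intro r hr
    rw [mem_Ico] at hr
    exact (sum_cycleWeight_rotation_swap hr.1 hr.2 hi h g).symm

theorem vertexRotation_pow_sub_pow {x : HalfEdge i} {k : ℕ} (hk : k ≤ i x.1) :
    (vertexRotation i ^ (i x.1 - k)) ((vertexRotation i ^ k) x) = x := by
  rw [← Perm.mul_apply, ← pow_add, Nat.sub_add_cancel hk, vertexRotation_pow_valency]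

/-- The arc of length `r` after `t` contains `h` exactly when `t` is one of the `r` half-edges
preceding `h` cyclically. -/
theorem card_mem_cyclicInterval (h : HalfEdge i) {r : ℕ} (hr : r ≤ i h.1) :
    #{t : HalfEdge i | h ∈ cyclicInterval t r} = r := by
  have : ({t : HalfEdge i | h ∈ cyclicInterval t r} : Finset _) =
      (Icc 1 r).image fun k => (vertexRotation i ^ (i h.1 - k)) h := by
    ext t
    rw [mem_filter, cyclicInterval, mem_image, mem_image]
    simp only [mem_univ, true_and, mem_Icc]
    constructor
    · rintro ⟨k, hk, rfl⟩
      rw [vertexRotation_pow_fst] at hr ⊢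
      exact ⟨k, hk, vertexRotation_pow_sub_pow (hk.2.trans hr)⟩
    · rintro ⟨k, hk, rfl⟩
      refine ⟨k, hk, ?_⟩
      rw [← Perm.mul_apply, ← pow_add, Nat.add_sub_cancel' (hk.2.trans hr),
        vertexRotation_pow_valency]
  rw [this, card_image_of_injOn, Nat.card_Icc, Nat.add_sub_cancel]
  intro a ha b hb hab
  rw [mem_coe, mem_Icc] at ha hb
  have key : ∀ c d, 1 ≤ c → c ≤ r → (vertexRotation i ^ (c + d))
      ((vertexRotation i ^ (i h.1 - c)) h) = (vertexRotation i ^ d) h := by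
    intro c d _ hc
    rw [← Perm.mul_apply, ← pow_add, show c + d + (i h.1 - c) = d + i h.1 by omega, pow_add,
      Perm.mul_apply, vertexRotation_pow_valency]
  have h1 : (vertexRotation i ^ b) h = (vertexRotation i ^ a) h := by
    rw [← key a b ha.1 ha.2, ← key b a hb.1 hb.2, add_comm b a]
    exact congrArg _ hab
  exact (vertexRotation_pow_injOn h ⟨hb.1, hb.2.trans hr⟩ ⟨ha.1, ha.2.trans hr⟩ h1).symm

theorem card_notMem_cyclicInterval (h : HalfEdge i) {j : Fin n} {r : ℕ} (hr : r ≤ i j) :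
    (∑ a : Fin (i j), if h ∈ cyclicInterval ⟨j, a⟩ r then 0 else 1 : ℤ) =
      if j = h.1 then (i j : ℤ) - r else i j := by
  split_ifs with hj
  · subst hj
    have h1 : (∑ a : Fin (i h.1), if h ∈ cyclicInterval ⟨h.1, a⟩ r then 1 else 0 : ℤ) = r := by
      have h0 : (r : ℤ) = #{t : HalfEdge i | h ∈ cyclicInterval t r} := by
        rw [card_mem_cyclicInterval h hr]
      rw [h0, natCast_card_filter, Fintype.sum_sigma,
        Fintype.sum_eq_single h.1]
      intro j hj
      refine sum_eq_zero fun a _ => if_neg fun h' => hj ?_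
      exact (fst_of_mem_cyclicInterval h').symm
    have h2 : (∑ a : Fin (i h.1), ((if h ∈ cyclicInterval ⟨h.1, a⟩ r then 0 else 1) +
        if h ∈ cyclicInterval ⟨h.1, a⟩ r then 1 else 0) : ℤ) = i h.1 := by
      rw [sum_congr rfl (g := fun _ => (1 : ℤ)) fun a _ => by split_ifs <;> rfl]
      simp
    rw [sum_add_distrib, h1] at h2
    linarith
  · rw [sum_congr rfl (g := fun _ => (1 : ℤ)) fun a _ =>
      if_neg fun h' => hj (fst_of_mem_cyclicInterval h').symm]
    simp

/-- Apart from the condition on `h`, a term depends on `t` only through its vertex. The coefficient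
counts the starting points `t` whose arc avoids `h`: all of them, less `r` at the vertex of `h`. -/
theorem sum_all_rotation_swap (hi : ∀ j, 1 ≤ i j) (h : HalfEdge i) (g : ℕ → ℤ) :
    ∑ S with h ∉ S, ∑ s ∈ S, ∑ t ∈ Sᶜ, cycleWeight (vertexRotation i * swap s t) S * g #S =
      -∑ j, ∑ C ∈ ((univ.erase h.1).erase j).powerset, (-1) ^ #C *
        ∑ r ∈ Ico 1 (i j), (if j = h.1 then (i j : ℤ) - r else i j) *
          g (r + ∑ j ∈ C, i j) := by
  have h1 : ∑ S with h ∉ S, ∑ s ∈ S, ∑ t ∈ Sᶜ,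
      cycleWeight (vertexRotation i * swap s t) S * g #S =
      ∑ t, ∑ s, ∑ S with h ∉ S ∧ s ∈ S ∧ t ∉ S,
        cycleWeight (vertexRotation i * swap s t) S * g #S := by
    have : ∀ S : Finset (HalfEdge i), ∑ s ∈ S, ∑ t ∈ Sᶜ,
        cycleWeight (vertexRotation i * swap s t) S * g #S =
        ∑ t, ∑ s, if s ∈ S ∧ t ∉ S then
          cycleWeight (vertexRotation i * swap s t) S * g #S else 0 := by
      intro S
      rw [sum_comm]
      refine Eq.trans (sum_congr rfl fun t ht => ?_) (sum_subset (subset_univ Sᶜ) ?_)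
      · simp [mem_compl.1 ht]
      · intro t _ ht
        refine sum_eq_zero fun s _ => if_neg fun h' => ?_
        exact ht (mem_compl.2 h'.2)
    rw [sum_congr rfl fun S _ => this S, sum_comm]
    refine sum_congr rfl fun t _ => ?_
    rw [sum_comm]
    refine sum_congr rfl fun s _ => ?_
    rw [← filter_filter, sum_filter (fun S => s ∈ S ∧ t ∉ S)]
  rw [h1, sum_congr rfl fun t _ => sum_rotation_swap t hi h g, Fintype.sum_sigma, ← sum_neg_distrib]
  refine sum_congr rfl fun j _ => ?_
  simp only
  rw [sum_comm]
  simp only [mul_sum]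
  rw [sum_comm (s := powerset _), ← sum_neg_distrib]
  refine sum_congr rfl fun r hr => ?_
  have h2 := card_notMem_cyclicInterval h (mem_Ico.1 hr).2.le
  simp only [← h2, ← sum_neg_distrib]
  have h3 : ∀ K : ℤ, (∑ a : Fin (i j), if h ∈ cyclicInterval ⟨j, a⟩ r then 0 else K) =
      (∑ a : Fin (i j), if h ∈ cyclicInterval ⟨j, a⟩ r then 0 else 1) * K := by
    intro K
    rw [sum_mul]
    exact sum_congr rfl fun a _ => by split_ifs <;> simp
  rw [h3, mul_sum]
  exact sum_congr rfl fun C _ => by ring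

/-- The number of one-face ribbon graphs with given valencies, as a signed sum. -/
theorem card_pairings_vertexRotation (hi : ∀ j, 1 ≤ i j) (h : HalfEdge i) :
    (#{e ∈ pairings (HalfEdge i) | ∀ x, (vertexRotation i * e).SameCycle h x} : ℤ) =
      ∑ C ∈ (univ.erase h.1).powerset, (-1) ^ #C *
        (matchSum (-1) (∑ j ∈ C, i j) * matchSum 1 (∑ j, i j - ∑ j ∈ C, i j)) -
      ∑ j, ∑ C ∈ ((univ.erase h.1).erase j).powerset, (-1) ^ #C *
        ∑ r ∈ Ico 1 (i j), (if j = h.1 then (i j : ℤ) - r else i j) *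
          (matchSum (-1) (r + ∑ j ∈ C, i j - 1) *
            matchSum 1 (∑ j, i j - (r + ∑ j ∈ C, i j) - 1)) := by
  have hcard : Fintype.card (HalfEdge i) = ∑ j, i j := by simp
  rw [card_pairings_transitive, sum_add_distrib,
    sum_cycleWeight_vertexRotation hi h
      (fun k => matchSum (-1) k * matchSum 1 (Fintype.card (HalfEdge i) - k)),
    sum_all_rotation_swap hi h
      (fun k => matchSum (-1) (k - 1) * matchSum 1 (Fintype.card (HalfEdge i) - k - 1)), hcard,
    sub_eq_add_neg]

end Counting

/-! ### From one-face ribbon graphs to transitive products -/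

namespace RibbonGraph

open Equiv Equiv.Perm Finset

variable {H : Type*}

theorem numCycles_eq_one_iff {p : Perm H} (h : H) : numCycles p = 1 ↔ ∀ x, p.SameCycle h x := by
  rw [numCycles, Nat.card_eq_one_iff_unique]
  constructor
  · rintro ⟨hs, -⟩ x
    exact Quotient.exact (Subsingleton.elim (Quotient.mk (SameCycle.setoid p) h) (Quotient.mk _ x))
  · refine fun hx => ⟨⟨fun a b => ?_⟩, ⟨Quotient.mk _ h⟩⟩
    induction a using Quotient.inductionOn with | _ a
    induction b using Quotient.inductionOn with | _ b
    exact Quotient.sound ((hx a).symm.trans (hx b))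

theorem numCycles_vertexRotation {n : ℕ} {i : Fin n → ℕ} (hi : ∀ j, 1 ≤ i j) :
    numCycles (vertexRotation i) = n := by
  have hfst : ∀ x y : HalfEdge i, (vertexRotation i).SameCycle x y → x.1 = y.1 := by
    intro x y hxy
    obtain ⟨k, hk⟩ := hxy.exists_pow_eq'
    rw [← hk.2, vertexRotation_pow_fst]
  let f : Quotient (SameCycle.setoid (vertexRotation i)) → Fin n :=
    Quotient.lift (fun x => x.1) hfst
  have hf : Function.Bijective f := by
    constructor
    · intro a b hab
      induction a using Quotient.inductionOn with | _ a
      induction b using Quotient.inductionOn with | _ b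
      exact Quotient.sound (sameCycle_vertexRotation (x := a) (y := b) hab.symm)
    · exact fun j => ⟨Quotient.mk _ ⟨j, ⟨0, hi j⟩⟩, rfl⟩
  rw [numCycles, Nat.card_congr (Equiv.ofBijective f hf), Nat.card_fin]

theorem two_mul_numCycles_of_isPairing [Fintype H] {e : Perm H} (he : IsPairing e) :
    2 * numCycles e = Fintype.card H := by
  classical
  have hinv : ∀ x : H, ∀ y, e y ∈ ({x, e x} : Finset H) ↔ y ∈ ({x, e x} : Finset H) := by
    intro x
    apply apply_mem_iff_of_mapsTo
    simp [he.1]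
  have hfib : ∀ q : Quotient (SameCycle.setoid e),
      #{x : H | Quotient.mk (SameCycle.setoid e) x = q} = 2 := by
    intro q
    induction q using Quotient.inductionOn with | _ x
    rw [← card_pair (he.2 x).symm]
    congr 1
    ext y
    rw [mem_filter]
    constructor
    · rintro ⟨-, h⟩
      exact (SameCycle.symm (Quotient.exact h)).mem_of_invariant (hinv x) (by simp)
    · intro h
      refine ⟨mem_univ _, Quotient.sound ?_⟩
      rcases mem_insert.1 h with rfl | h
      · exact SameCycle.refl _ _
      · rw [mem_singleton.1 h]
        exact sameCycle_apply_left.2 (SameCycle.refl e x)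
  rw [← card_univ, card_eq_sum_card_fiberwise (f := Quotient.mk (SameCycle.setoid e)) (t := univ)
    fun _ _ => mem_coe.2 (mem_univ _), sum_congr rfl fun q _ => hfib q, numCycles,
    Nat.card_eq_fintype_card]
  simp [mul_comm]

theorem connected_of_sameCycle {Γ : RibbonGraph H} {h : H}
    (hc : ∀ x, (Γ.rot * Γ.edge).SameCycle h x) : Γ.Connected := by
  refine ⟨⟨h⟩, fun x y => ?_⟩
  obtain ⟨k, hk⟩ := (hc x).symm.trans (hc y)
  refine ⟨(Γ.rot * Γ.edge) ^ k, Subgroup.zpow_mem _ (Subgroup.mul_mem _ ?_ ?_) _, hk⟩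
  · exact Subgroup.subset_closure (by simp)
  · exact Subgroup.subset_closure (by simp)

/-- Connectedness and genus impose nothing further: the face passes through every half-edge, and the
numbers of vertices and edges are fixed by the valencies. -/
theorem card_oneFace {n g : ℕ} {i : Fin n → ℕ} (hi : ∀ j, 1 ≤ i j)
    (hsum : ∑ j, i j + 2 = 4 * g + 2 * n) (h : HalfEdge i) :
    Nat.card {Γ : RibbonGraph (HalfEdge i) //
      Γ.rot = vertexRotation i ∧ Γ.Connected ∧ Γ.HasGenus g ∧ Γ.numFaces = 1} =
      #{e ∈ pairings (HalfEdge i) | ∀ x, (vertexRotation i * e).SameCycle h x} := by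
  rw [← Nat.card_eq_finsetCard]
  refine Nat.card_congr
    { toFun := fun Γ => ⟨Γ.1.edge, mem_filter.2
        ⟨mem_pairings.2 ⟨Γ.1.edge_edge, Γ.1.edge_ne⟩, ?_⟩⟩
      invFun := fun e => ⟨⟨vertexRotation i, e.1, (mem_pairings.1 (mem_filter.1 e.2).1).1,
        (mem_pairings.1 (mem_filter.1 e.2).1).2⟩, rfl, ?_, ?_, ?_⟩
      left_inv := ?_
      right_inv := fun e => rfl }
  · rw [← numCycles_eq_one_iff]
    exact (congrArg (fun p => numCycles (p * Γ.1.edge)) Γ.2.1).symm.trans Γ.2.2.2.2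
  · exact connected_of_sameCycle (mem_filter.1 e.2).2
  · have h1 := two_mul_numCycles_of_isPairing (mem_pairings.1 (mem_filter.1 e.2).1)
    have h2 := (numCycles_eq_one_iff h).2 (mem_filter.1 e.2).2
    simp only [HasGenus, numVertices, numEdges, numFaces, numCycles_vertexRotation hi, h2]
    have h3 : Fintype.card (HalfEdge i) = ∑ j, i j := by simp
    omega
  · exact (numCycles_eq_one_iff h).2 (mem_filter.1 e.2).2
  · rintro ⟨⟨r, e, h1, h2⟩, hrot, _⟩
    have hr : r = vertexRotation i := hrot
    subst hr
    rfl

end RibbonGraph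

/-! ### Matching numbers and the telescoping arc sum -/

section MatchSums

open Finset

theorem matchSum_two_mul (ε : ℤ) (k : ℕ) : matchSum ε (2 * k) = ε ^ k * matchSum 1 (2 * k) := by
  induction k with
  | zero => simp [matchSum]
  | succ k ih =>
    rw [show 2 * (k + 1) = 2 * k + 2 by ring, matchSum, matchSum, ih]
    ring

theorem matchSum_one_two_mul (k : ℕ) : matchSum 1 (2 * k) = ((2 * k - 1)‼ : ℕ) := by
  induction k with
  | zero => simp [matchSum]
  | succ k ih =>
    rw [show 2 * (k + 1) = 2 * k + 2 by ring, matchSum, ih]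
    rcases k with _ | k
    · simp
    · rw [show 2 * (k + 1) + 2 - 1 = (2 * (k + 1) - 1) + 2 by omega, Nat.doubleFactorial_add_two,
        show 2 * (k + 1) - 1 + 2 = 2 * (k + 1) + 1 by omega]
      push_cast
      ring

/-- A discrete primitive of `k ↦ (M + 2) * matchSum (-1) k * matchSum 1 (M - k)`. -/
def matchPrimitive (M k : ℕ) : ℤ :=
  -(matchSum (-1) k * matchSum 1 (M + 2 - k) + matchSum (-1) (k + 1) * matchSum 1 (M + 1 - k))

/-- With `l = M - k`, the recursion extracts `k + 1` from the signed factor and `l + 1` from the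
plain one; the mixed terms cancel and `(k + 1) + (l + 1) = M + 2`. -/
theorem matchPrimitive_succ {M k : ℕ} (hk : k ≤ M) :
    matchPrimitive M (k + 1) =
      matchPrimitive M k + (M + 2) * (matchSum (-1) k * matchSum 1 (M - k)) := by
  obtain ⟨l, rfl⟩ := Nat.exists_eq_add_of_le hk
  rw [matchPrimitive, matchPrimitive, show k + l + 2 - (k + 1) = l + 1 by omega,
    show k + l + 1 - (k + 1) = l by omega, show k + l + 2 - k = l + 2 by omega,
    show k + l + 1 - k = l + 1 by omega, show k + l - k = l by omega, matchSum, matchSum]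
  push_cast
  ring

theorem mul_sum_matchSum {M a b : ℕ} (hab : a ≤ b) (hb : b ≤ M + 1) :
    (M + 2) * ∑ k ∈ Ico a b, matchSum (-1) k * matchSum 1 (M - k) =
      matchPrimitive M b - matchPrimitive M a := by
  induction b, hab using Nat.le_induction with
  | base => simp
  | succ b hab ih =>
    rw [sum_Ico_succ_top hab, mul_add, ih (by omega), matchPrimitive_succ (by omega)]
    ring

/-- The signed sum over the arcs at a vertex whose valency is all but `q` of `M + 2` half-edges. -/
theorem sum_arcs_matchSum {M c q d : ℕ} (hd : d + (q + c) = M + 2) (hd1 : 1 ≤ d) :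
    ((M : ℤ) + 2) * (M + 4) * ∑ r ∈ Ico 1 d, ((d : ℤ) - r) *
      (matchSum (-1) (r + c - 1) * matchSum 1 (M + 2 - (r + c) - 1)) =
    (M + 2) * (matchPrimitive (M + 2) (c + d - 1) - matchPrimitive (M + 2) c) -
      (M + 4) * (q * (matchPrimitive M (c + d - 1) - matchPrimitive M c)) := by
  rw [← mul_sum_matchSum (M := M) (by omega) (by omega),
    ← mul_sum_matchSum (M := M + 2) (by omega) (by omega)]
  -- With `k = r + c - 1` and `l = M - k`, the factor `d - r` is `(l + 1) - q`, and `l + 1` is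
  -- absorbed by `matchSum 1 (l + 2) = (l + 1) * matchSum 1 l`. Both resulting sums telescope.
  have h : ∑ r ∈ Ico 1 d, ((d : ℤ) - r) *
      (matchSum (-1) (r + c - 1) * matchSum 1 (M + 2 - (r + c) - 1)) =
      ∑ k ∈ Ico c (c + d - 1), (matchSum (-1) k * matchSum 1 (M + 2 - k) -
        q * (matchSum (-1) k * matchSum 1 (M - k))) := by
    rw [sum_Ico_eq_sum_range, sum_Ico_eq_sum_range, show c + d - 1 - c = d - 1 by omega]
    refine sum_congr rfl fun r hr => ?_
    rw [mem_range] at hr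
    obtain ⟨l, hl⟩ := Nat.exists_eq_add_of_le (show c + r ≤ M by omega)
    rw [show 1 + r + c - 1 = c + r by omega, show M + 2 - (1 + r + c) - 1 = l by omega,
      show M + 2 - (c + r) = l + 2 by omega, show M - (c + r) = l by omega, matchSum]
    have h2 : (d : ℤ) = l + c + r + 2 - q - c := by omega
    rw [h2]
    push_cast
    ring
  rw [h, sum_sub_distrib, ← mul_sum]
  push_cast
  ring

end MatchSums

/-! ### Functions of the genus that are rational without poles -/

section Rationality

open Polynomial Finset

/-- On the set `s`, the function `u` agrees with a rational function without poles in `s`. -/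
def RationalOn (s : Set ℕ) (u : ℕ → ℚ) : Prop :=
  ∃ P Q : ℚ[X], ∀ g ∈ s, Q.eval (g : ℚ) ≠ 0 ∧ u g * Q.eval (g : ℚ) = P.eval (g : ℚ)

namespace RationalOn

variable {s : Set ℕ} {u v : ℕ → ℚ}

theorem congr (hu : RationalOn s u) (h : ∀ g ∈ s, v g = u g) : RationalOn s v := by
  obtain ⟨P, Q, hPQ⟩ := hu
  exact ⟨P, Q, fun g hg => ⟨(hPQ g hg).1, h g hg ▸ (hPQ g hg).2⟩⟩

theorem eval (P : ℚ[X]) : RationalOn s fun g => P.eval (g : ℚ) :=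
  ⟨P, 1, fun g _ => by simp⟩

theorem const (c : ℚ) : RationalOn s fun _ => c :=
  ⟨C c, 1, fun g _ => by simp⟩

theorem add (hu : RationalOn s u) (hv : RationalOn s v) : RationalOn s fun g => u g + v g := by
  obtain ⟨P, Q, h⟩ := hu
  obtain ⟨P', Q', h'⟩ := hv
  refine ⟨P * Q' + P' * Q, Q * Q', fun g hg => ⟨?_, ?_⟩⟩
  · rw [eval_mul]
    exact mul_ne_zero (h g hg).1 (h' g hg).1
  · rw [eval_mul, eval_add, eval_mul, eval_mul, ← (h g hg).2, ← (h' g hg).2]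
    ring

theorem mul (hu : RationalOn s u) (hv : RationalOn s v) : RationalOn s fun g => u g * v g := by
  obtain ⟨P, Q, h⟩ := hu
  obtain ⟨P', Q', h'⟩ := hv
  refine ⟨P * P', Q * Q', fun g hg => ⟨?_, ?_⟩⟩
  · rw [eval_mul]
    exact mul_ne_zero (h g hg).1 (h' g hg).1
  · rw [eval_mul, eval_mul, ← (h g hg).2, ← (h' g hg).2]
    ring

theorem neg (hu : RationalOn s u) : RationalOn s fun g => -u g :=
  ((const (-1)).mul hu).congr fun g _ => by ring

theorem sub (hu : RationalOn s u) (hv : RationalOn s v) : RationalOn s fun g => u g - v g :=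
  (hu.add hv.neg).congr fun g _ => by ring

theorem sum {ι : Type*} (t : Finset ι) {u : ι → ℕ → ℚ} (hu : ∀ j ∈ t, RationalOn s (u j)) :
    RationalOn s fun g => ∑ j ∈ t, u j g := by
  classical
  induction t using Finset.induction_on with
  | empty => exact (const 0).congr fun g _ => by simp
  | insert j t hj ih =>
    refine ((hu j (mem_insert_self j t)).add
      (ih fun k hk => hu k (mem_insert_of_mem hk))).congr fun g _ => ?_
    rw [sum_insert hj]

/-- A function is rational if its product with a nonvanishing polynomial is. -/
theorem of_eval_mul (W : ℚ[X]) (hW : ∀ g ∈ s, W.eval (g : ℚ) ≠ 0)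
    (hu : RationalOn s fun g => W.eval (g : ℚ) * u g) : RationalOn s u := by
  obtain ⟨P, Q, h⟩ := hu
  refine ⟨P, W * Q, fun g hg => ⟨?_, ?_⟩⟩
  · rw [eval_mul]
    exact mul_ne_zero (hW g hg) (h g hg).1
  · rw [eval_mul, ← (h g hg).2]
    ring

theorem exists_ratFunc (hu : RationalOn s u) :
    ∃ R : RatFunc ℚ, ∀ g ∈ s, R.denom.eval (g : ℚ) ≠ 0 ∧ u g = R.eval (RingHom.id ℚ) (g : ℚ) := by
  obtain ⟨P, Q, h⟩ := hu
  refine ⟨algebraMap ℚ[X] (RatFunc ℚ) P / algebraMap ℚ[X] (RatFunc ℚ) Q, fun g hg => ?_⟩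
  obtain ⟨hQ, hP⟩ := h g hg
  have hQ0 : Q ≠ 0 := by
    rintro rfl
    simp at hQ
  set R := algebraMap ℚ[X] (RatFunc ℚ) P / algebraMap ℚ[X] (RatFunc ℚ) Q with hR
  -- The reduced denominator divides `Q`, so it has no zero where `Q` has none.
  have hden : R.denom.eval (g : ℚ) ≠ 0 := by
    obtain ⟨T, hT⟩ := RatFunc.denom_div_dvd P Q
    intro h0
    apply hQ
    rw [hT, eval_mul, ← hR, h0, zero_mul]
  refine ⟨hden, ?_⟩
  have h1 := congrArg (Polynomial.eval (g : ℚ)) ((RatFunc.num_mul_eq_mul_denom_iff hQ0).2 hR)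
  rw [eval_mul, eval_mul, ← hP] at h1
  rw [RatFunc.eval, eval₂_id, eval₂_id, eq_div_iff hden]
  apply mul_right_cancel₀ hQ
  rw [h1]
  ring

end RationalOn

end Rationality

/-! ### Ratios of matching numbers as functions of the genus -/

section MatchSumRatios

open Polynomial Finset

theorem matchSum_two_mul_add_one (ε : ℤ) (k : ℕ) : matchSum ε (2 * k + 1) = 0 := by
  induction k with
  | zero => rfl
  | succ k ih => rw [show 2 * (k + 1) + 1 = 2 * k + 1 + 2 by ring, matchSum, ih, mul_zero]

theorem matchSum_one_two_mul_ne_zero (k : ℕ) : matchSum 1 (2 * k) ≠ 0 := by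
  rw [matchSum_one_two_mul]
  exact_mod_cast (Nat.doubleFactorial_pos _).ne'

/-- The genera for which the last vertex has positive valency. -/
def genusDomain (n m : ℕ) : Set ℕ := {g | 1 ≤ 4 * g + 2 * n - 2 - m}

/-- On the domain `2 * g + n ≥ 2`, so the truncated subtraction in `4 * g + 2 * n - 4` is exact; the
total number of half-edges is `2 * k + 2`. -/
theorem exists_of_mem_genusDomain {n m g : ℕ} (hg : g ∈ genusDomain n m) :
    ∃ k, 2 * g + n = k + 2 ∧ 4 * g + 2 * n - 4 = 2 * k ∧ m + 1 ≤ 2 * k + 2 := by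
  have h : 1 ≤ 4 * g + 2 * n - 2 - m := hg
  exact ⟨2 * g + n - 2, by omega, by omega, by omega⟩

/-- Descend from the top in steps of two; each step divides by a linear polynomial in `g`, and the
bound on `l` keeps that divisor positive on the domain. Odd `l` give zero. -/
theorem rationalOn_matchSum_ratio (n m : ℕ) {ε : ℤ} (hε : ε ^ 2 = 1) (l : ℕ) (hl : l ≤ m + 3) :
    RationalOn (genusDomain n m) fun g =>
      (matchSum ε (4 * g + 2 * n - 4 + 4 - l) : ℚ) / matchSum 1 (4 * g + 2 * n - 4) := by
  induction l using Nat.twoStepInduction with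
  | zero =>
    refine (RationalOn.eval (C ((ε : ℚ) ^ n) * (C 4 * X + C (2 * (n : ℚ) - 1)) *
      (C 4 * X + C (2 * (n : ℚ) - 3)))).congr fun g hg => ?_
    obtain ⟨k, hk, hM, -⟩ := exists_of_mem_genusDomain hg
    have h0 : (matchSum 1 (2 * k) : ℚ) ≠ 0 := by exact_mod_cast matchSum_one_two_mul_ne_zero k
    -- Since `k = 2 * g + n - 2` has the parity of `n`, the sign does not vary with `g`.
    have hpow : (ε : ℚ) ^ k * ε ^ 2 = ε ^ n := by
      have h2 : (ε : ℚ) ^ 2 = 1 := by exact_mod_cast hε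
      rw [← pow_add, ← hk, pow_add, pow_mul, h2, one_pow, one_mul]
    have hkq : 2 * (g : ℚ) + n = k + 2 := by exact_mod_cast hk
    have hn : (n : ℚ) = k + 2 - 2 * g := by linarith
    rw [hM, Nat.sub_zero, show 2 * k + 4 = 2 * k + 2 + 2 by ring, matchSum, matchSum,
      matchSum_two_mul, div_eq_iff h0]
    simp only [eval_mul, eval_add, eval_C, eval_X]
    push_cast
    rw [← hpow, hn]
    ring
  | one =>
    refine (RationalOn.const 0).congr fun g hg => ?_
    obtain ⟨k, -, hM, -⟩ := exists_of_mem_genusDomain hg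
    rw [hM, show 2 * k + 4 - 1 = 2 * (k + 1) + 1 by omega, matchSum_two_mul_add_one]
    simp
  | more l ih _ =>
    have hW : ∀ g ∈ genusDomain n m, ∃ K : ℕ, 4 * g + 2 * n - 4 + 4 - (l + 2) = K ∧
        4 * g + 2 * n - 4 + 4 - l = K + 2 ∧
        (C 4 * X + C (2 * (n : ℚ) - 1 - l)).eval (g : ℚ) = (K : ℚ) + 1 := by
      intro g hg
      obtain ⟨k, hk, hM, hm⟩ := exists_of_mem_genusDomain hg
      obtain ⟨K, hK⟩ := Nat.exists_eq_add_of_le (show l ≤ 2 * k + 2 by omega)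
      refine ⟨K, by omega, by omega, ?_⟩
      have h1 : 2 * (g : ℚ) + n = k + 2 := by exact_mod_cast hk
      have h2 : 2 * (k : ℚ) + 2 = l + K := by exact_mod_cast hK
      simp only [eval_mul, eval_add, eval_C, eval_X]
      linarith
    apply RationalOn.of_eval_mul (C 4 * X + C (2 * (n : ℚ) - 1 - l))
    · intro g hg
      obtain ⟨K, -, -, hK⟩ := hW g hg
      rw [hK]
      positivity
    · refine ((RationalOn.const (ε : ℚ)).mul (ih (by omega))).congr fun g hg => ?_
      obtain ⟨K, h1, h2, hK⟩ := hW g hg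
      have hε' : (ε : ℚ) * ε = 1 := by
        rw [← sq]
        exact_mod_cast hε
      rw [hK, h1, h2, matchSum]
      push_cast
      linear_combination (-((K : ℚ) + 1) * (matchSum ε K / matchSum 1 (4 * g + 2 * n - 4))) * hε'

/-- At the lower end of the telescoped sum the signed factors are constants and the plain ones vary
with `g`. -/
theorem rationalOn_matchPrimitive_add_two {n m c : ℕ} (hc : c ≤ m) :
    RationalOn (genusDomain n m) fun g =>
      (matchPrimitive (4 * g + 2 * n - 4 + 2) c : ℚ) / matchSum 1 (4 * g + 2 * n - 4) := by
  refine (((RationalOn.const (matchSum (-1) c : ℚ)).mul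
    (rationalOn_matchSum_ratio n m (one_pow 2) c (by omega))).add
    ((RationalOn.const (matchSum (-1) (c + 1) : ℚ)).mul
    (rationalOn_matchSum_ratio n m (one_pow 2) (c + 1) (by omega)))).neg.congr fun g _ => ?_
  rw [matchPrimitive, show 4 * g + 2 * n - 4 + 2 + 1 - c = 4 * g + 2 * n - 4 + 4 - (c + 1) by omega]
  push_cast
  ring

theorem rationalOn_matchPrimitive {n m c : ℕ} (hc : c ≤ m) :
    RationalOn (genusDomain n m) fun g =>
      (matchPrimitive (4 * g + 2 * n - 4) c : ℚ) / matchSum 1 (4 * g + 2 * n - 4) := by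
  refine (((RationalOn.const (matchSum (-1) c : ℚ)).mul
    (rationalOn_matchSum_ratio n m (one_pow 2) (c + 2) (by omega))).add
    ((RationalOn.const (matchSum (-1) (c + 1) : ℚ)).mul
    (rationalOn_matchSum_ratio n m (one_pow 2) (c + 3) (by omega)))).neg.congr fun g _ => ?_
  rw [matchPrimitive, show 4 * g + 2 * n - 4 + 1 - c = 4 * g + 2 * n - 4 + 4 - (c + 3) by omega,
    show 4 * g + 2 * n - 4 + 2 - c = 4 * g + 2 * n - 4 + 4 - (c + 2) by omega]
  push_cast
  ring

/-- At the upper end the roles are exchanged: the plain factors are constants and the signed ones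
vary with `g`. -/
theorem rationalOn_matchPrimitive_add_two_sub {n m q : ℕ} (hq : q ≤ m) :
    RationalOn (genusDomain n m) fun g =>
      (matchPrimitive (4 * g + 2 * n - 4 + 2) (4 * g + 2 * n - 4 + 1 - q) : ℚ) /
        matchSum 1 (4 * g + 2 * n - 4) := by
  refine (((RationalOn.const (matchSum 1 (q + 3) : ℚ)).mul
    (rationalOn_matchSum_ratio n m (neg_one_sq) (q + 3) (by omega))).add
    ((RationalOn.const (matchSum 1 (q + 2) : ℚ)).mul
    (rationalOn_matchSum_ratio n m (neg_one_sq) (q + 2) (by omega)))).neg.congr fun g hg => ?_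
  obtain ⟨k, -, hM, hm⟩ := exists_of_mem_genusDomain hg
  rw [matchPrimitive, hM, show 2 * k + 2 + 2 - (2 * k + 1 - q) = q + 3 by omega,
    show 2 * k + 2 + 1 - (2 * k + 1 - q) = q + 2 by omega,
    show 2 * k + 1 - q + 1 = 2 * k + 4 - (q + 2) by omega,
    show 2 * k + 1 - q = 2 * k + 4 - (q + 3) by omega]
  push_cast
  ring

theorem rationalOn_matchPrimitive_sub {n m q : ℕ} (hq : q ≤ m) :
    RationalOn (genusDomain n m) fun g =>
      (matchPrimitive (4 * g + 2 * n - 4) (4 * g + 2 * n - 4 + 1 - q) : ℚ) /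
        matchSum 1 (4 * g + 2 * n - 4) := by
  refine (((RationalOn.const (matchSum 1 (q + 1) : ℚ)).mul
    (rationalOn_matchSum_ratio n m (neg_one_sq) (q + 3) (by omega))).add
    ((RationalOn.const (matchSum 1 q : ℚ)).mul
    (rationalOn_matchSum_ratio n m (neg_one_sq) (q + 2) (by omega)))).neg.congr fun g hg => ?_
  obtain ⟨k, -, hM, hm⟩ := exists_of_mem_genusDomain hg
  rw [matchPrimitive, hM, show 2 * k + 2 - (2 * k + 1 - q) = q + 1 by omega,
    show 2 * k + 1 - (2 * k + 1 - q) = q by omega,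
    show 2 * k + 1 - q + 1 = 2 * k + 4 - (q + 2) by omega,
    show 2 * k + 1 - q = 2 * k + 4 - (q + 3) by omega]
  push_cast
  ring

theorem rationalOn_sum_arcs {n m c : ℕ} (hc : c ≤ m) :
    RationalOn (genusDomain n m) fun g =>
      ((∑ r ∈ Ico 1 (4 * g + 2 * n - 2 - m), (((4 * g + 2 * n - 2 - m : ℕ) : ℤ) - r) *
        (matchSum (-1) (r + c - 1) * matchSum 1 (4 * g + 2 * n - 4 + 2 - (r + c) - 1)) : ℤ) : ℚ) /
        matchSum 1 (4 * g + 2 * n - 4) := by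
  have hW : ∀ g ∈ genusDomain n m,
      (C 4 * X + C (2 * (n : ℚ) - 2)).eval (g : ℚ) = ((4 * g + 2 * n - 4 : ℕ) : ℚ) + 2 ∧
      (C 4 * X + C (2 * (n : ℚ))).eval (g : ℚ) = ((4 * g + 2 * n - 4 : ℕ) : ℚ) + 4 := by
    intro g hg
    obtain ⟨k, hk, hM, -⟩ := exists_of_mem_genusDomain hg
    have hkq : 2 * (g : ℚ) + n = k + 2 := by exact_mod_cast hk
    simp only [eval_mul, eval_add, eval_C, eval_X, hM]
    push_cast
    constructor <;> linarith
  apply RationalOn.of_eval_mul ((C 4 * X + C (2 * (n : ℚ) - 2)) * (C 4 * X + C (2 * (n : ℚ))))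
  · intro g hg
    rw [eval_mul, (hW g hg).1, (hW g hg).2]
    positivity
  -- The last valency is `M + 2 - m` with `M = 4 * g + 2 * n - 4`, so the constant `q` of
  -- `sum_arcs_matchSum` is `m - c`.
  · have hq : m - c ≤ m := Nat.sub_le _ _
    refine (((RationalOn.eval (C 4 * X + C (2 * (n : ℚ) - 2))).mul
      ((rationalOn_matchPrimitive_add_two_sub hq).sub (rationalOn_matchPrimitive_add_two hc))).sub
      ((RationalOn.eval (C 4 * X + C (2 * (n : ℚ)))).mul
      ((RationalOn.const ((m - c : ℕ) : ℚ)).mul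
      ((rationalOn_matchPrimitive_sub hq).sub (rationalOn_matchPrimitive hc))))).congr
      fun g hg => ?_
    have hg' : 1 ≤ 4 * g + 2 * n - 2 - m := hg
    obtain ⟨k, hk, hM, hm⟩ := exists_of_mem_genusDomain hg
    have key := sum_arcs_matchSum (M := 4 * g + 2 * n - 4) (c := c) (q := m - c)
      (d := 4 * g + 2 * n - 2 - m) (by omega) hg'
    rw [show c + (4 * g + 2 * n - 2 - m) - 1 = 4 * g + 2 * n - 4 + 1 - (m - c) by omega] at key
    have key' := congrArg (fun z : ℤ => (z : ℚ)) key
    rw [eval_mul, (hW g hg).1, (hW g hg).2, ← mul_div_assoc]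
    rw [Int.cast_mul] at key'
    have hcast : (((((4 * g + 2 * n - 4 : ℕ) : ℤ) + 2) * (((4 * g + 2 * n - 4 : ℕ) : ℤ) + 4) : ℤ) : ℚ)
      = (((4 * g + 2 * n - 4 : ℕ) : ℚ) + 2) * (((4 * g + 2 * n - 4 : ℕ) : ℚ) + 4) := by
      push_cast
      ring
    rw [hcast] at key'
    rw [key']
    simp only [Int.cast_sub, Int.cast_mul, Int.cast_add, Int.cast_natCast, Int.cast_ofNat]
    ring

end MatchSumRatios

/-! ### Assembling the formula with the base point at the last vertex -/

section Main

open Finset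

theorem appendLast_of_ne {n : ℕ} (i : Fin (n - 1) → ℕ) (d : ℕ) {ℓ : Fin n} (hℓ : (ℓ : ℕ) = n - 1)
    {j : Fin n} (hj : j ≠ ℓ) : appendLast i d j = appendLast i 0 j := by
  have : (j : ℕ) < n - 1 := by
    have := j.2
    have : (j : ℕ) ≠ ℓ := fun h => hj (Fin.ext h)
    omega
  simp only [appendLast, dif_pos this]

theorem appendLast_last {n : ℕ} (i : Fin (n - 1) → ℕ) (d : ℕ) {ℓ : Fin n}
    (hℓ : (ℓ : ℕ) = n - 1) : appendLast i d ℓ = d := by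
  simp [appendLast, hℓ]

theorem sum_appendLast {n : ℕ} (hn : 1 ≤ n) (i : Fin (n - 1) → ℕ) (d : ℕ) :
    ∑ j, appendLast i d j = ∑ j, i j + d := by
  obtain ⟨k, rfl⟩ : ∃ k, n = k + 1 := ⟨n - 1, by omega⟩
  rw [Fin.sum_univ_castSucc]
  congr 1
  · exact sum_congr rfl fun j _ => by simp [appendLast]
  · simp [appendLast]

theorem appendLast_pos {n : ℕ} {i : Fin (n - 1) → ℕ} (hi : ∀ j, 1 ≤ i j) {d : ℕ} (hd : 1 ≤ d)
    (j : Fin n) : 1 ≤ appendLast i d j := by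
  rw [appendLast]
  split_ifs
  exacts [hi _, hd]

theorem normalizedRG_eq {n g : ℕ} (hn : 1 ≤ n) (i : Fin (n - 1) → ℕ) (hi : ∀ j, 1 ≤ i j)
    (hg : g ∈ genusDomain n (∑ j, i j)) {ℓ : Fin n} (hℓ : (ℓ : ℕ) = n - 1) :
    normalizedRG g (appendLast i (4 * g + 2 * n - 2 - ∑ j, i j)) =
      (1 / 2) * (∑ C ∈ (univ.erase ℓ).powerset, (-1) ^ #C *
          (matchSum (-1) (∑ j ∈ C, appendLast i 0 j) *
            ((matchSum 1 (4 * g + 2 * n - 4 + 4 - (∑ j ∈ C, appendLast i 0 j + 2)) : ℚ) /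
              matchSum 1 (4 * g + 2 * n - 4))) -
        (∑ j ∈ univ.erase ℓ, ∑ C ∈ ((univ.erase ℓ).erase j).powerset, (-1) ^ #C *
          ∑ r ∈ Ico 1 (appendLast i 0 j), (appendLast i 0 j : ℚ) *
            (matchSum (-1) (r + ∑ j ∈ C, appendLast i 0 j - 1) *
            ((matchSum 1 (4 * g + 2 * n - 4 + 4 - (r + ∑ j ∈ C, appendLast i 0 j + 3)) : ℚ) /
              matchSum 1 (4 * g + 2 * n - 4))) +
        ∑ C ∈ (univ.erase ℓ).powerset, (-1) ^ #C *
          (((∑ r ∈ Ico 1 (4 * g + 2 * n - 2 - ∑ j, i j),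
            (((4 * g + 2 * n - 2 - ∑ j, i j : ℕ) : ℤ) - r) *
            (matchSum (-1) (r + ∑ j ∈ C, appendLast i 0 j - 1) *
              matchSum 1 (4 * g + 2 * n - 4 + 2 - (r + ∑ j ∈ C, appendLast i 0 j) - 1)) : ℤ) : ℚ) /
            matchSum 1 (4 * g + 2 * n - 4)))) := by
  set m := ∑ j, i j with hm
  set d := 4 * g + 2 * n - 2 - m with hd
  have hd1 : 1 ≤ d := hg
  obtain ⟨k, hk, hM, hmk⟩ := exists_of_mem_genusDomain hg
  have hpos := appendLast_pos hi hd1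
  have htot : ∑ j, appendLast i d j = 2 * k + 2 := by
    rw [sum_appendLast hn]
    omega
  have h0 : (matchSum 1 (2 * k) : ℚ) ≠ 0 := by exact_mod_cast matchSum_one_two_mul_ne_zero k
  have hdf : ((4 * g + 2 * n - 5)‼ : ℚ) = matchSum 1 (2 * k) := by
    rw [matchSum_one_two_mul, show 4 * g + 2 * n - 5 = 2 * k - 1 by omega]
    simp
  have hn0 : (n ! : ℚ) ≠ 0 := by exact_mod_cast (Nat.factorial_ne_zero n)
  have hC : ∀ C ⊆ univ.erase ℓ, ∑ j ∈ C, appendLast i d j = ∑ j ∈ C, appendLast i 0 j :=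
    fun C hC => sum_congr rfl fun j hj => appendLast_of_ne i d hℓ (ne_of_mem_erase (hC hj))
  -- With the base point at `ℓ`, the sets `C` consist of vertices of fixed valency only.
  have hcount := card_pairings_vertexRotation hpos ⟨ℓ, ⟨0, hpos ℓ⟩⟩
  rw [← RibbonGraph.card_oneFace (g := g) hpos (by rw [htot]; omega)] at hcount
  simp only [htot] at hcount
  -- The arcs at `ℓ` are separated off: theirs is the only sum whose length depends on `g`.
  rw [← add_sum_erase univ _ (mem_univ ℓ)] at hcount
  simp only [if_true, erase_idem, appendLast_last i d hℓ] at hcount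
  have e1 : ∑ C ∈ (univ.erase ℓ).powerset, (-1) ^ #C *
      (matchSum (-1) (∑ j ∈ C, appendLast i d j) *
        matchSum 1 (2 * k + 2 - ∑ j ∈ C, appendLast i d j)) =
      ∑ C ∈ (univ.erase ℓ).powerset, (-1) ^ #C *
      (matchSum (-1) (∑ j ∈ C, appendLast i 0 j) *
        matchSum 1 (2 * k + 4 - (∑ j ∈ C, appendLast i 0 j + 2))) := by
    refine sum_congr rfl fun C hCm => ?_
    rw [hC C (mem_powerset.1 hCm), show 2 * k + 4 - (∑ j ∈ C, appendLast i 0 j + 2) =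
      2 * k + 2 - ∑ j ∈ C, appendLast i 0 j by omega]
  have e2 : ∑ C ∈ (univ.erase ℓ).powerset, (-1) ^ #C * ∑ r ∈ Ico 1 d, ((d : ℤ) - r) *
      (matchSum (-1) (r + ∑ j ∈ C, appendLast i d j - 1) *
        matchSum 1 (2 * k + 2 - (r + ∑ j ∈ C, appendLast i d j) - 1)) =
      ∑ C ∈ (univ.erase ℓ).powerset, (-1) ^ #C * ∑ r ∈ Ico 1 d, ((d : ℤ) - r) *
      (matchSum (-1) (r + ∑ j ∈ C, appendLast i 0 j - 1) *
        matchSum 1 (2 * k + 2 - (r + ∑ j ∈ C, appendLast i 0 j) - 1)) := by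
    refine sum_congr rfl fun C hCm => ?_
    rw [hC C (mem_powerset.1 hCm)]
  have e3 : ∑ j ∈ univ.erase ℓ, ∑ C ∈ ((univ.erase ℓ).erase j).powerset, (-1) ^ #C *
      ∑ r ∈ Ico 1 (appendLast i d j),
        (if j = ℓ then (appendLast i d j : ℤ) - r else appendLast i d j) *
        (matchSum (-1) (r + ∑ j ∈ C, appendLast i d j - 1) *
          matchSum 1 (2 * k + 2 - (r + ∑ j ∈ C, appendLast i d j) - 1)) =
      ∑ j ∈ univ.erase ℓ, ∑ C ∈ ((univ.erase ℓ).erase j).powerset, (-1) ^ #C *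
      ∑ r ∈ Ico 1 (appendLast i 0 j), (appendLast i 0 j : ℤ) *
        (matchSum (-1) (r + ∑ j ∈ C, appendLast i 0 j - 1) *
          matchSum 1 (2 * k + 4 - (r + ∑ j ∈ C, appendLast i 0 j + 3))) := by
    refine sum_congr rfl fun j hj => sum_congr rfl fun C hCm => ?_
    rw [hC C ((mem_powerset.1 hCm).trans (erase_subset _ _)),
      appendLast_of_ne i d hℓ (ne_of_mem_erase hj)]
    simp only [if_neg (ne_of_mem_erase hj)]
    congr 1
    refine sum_congr rfl fun r _ => ?_
    rw [show 2 * k + 4 - (r + ∑ j ∈ C, appendLast i 0 j + 3) =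
      2 * k + 2 - (r + ∑ j ∈ C, appendLast i 0 j) - 1 by omega]
  rw [e1, e2, e3] at hcount
  have hcount' := congrArg (fun z : ℤ => (z : ℚ)) hcount
  simp only [Int.cast_natCast] at hcount'
  rw [normalizedRG, rg, hdf, hcount', hM]
  have hmul : ∀ A B : ℚ, (n ! : ℚ) / (2 * B) * (A / n !) = (1 / 2) * (A / B) := by
    intro A B
    field_simp
  rw [hmul]
  congr 1
  rw [Int.cast_sub, Int.cast_add, sub_div, add_div]
  congr 1
  · push_cast
    rw [sum_div]
    exact sum_congr rfl fun C _ => by ring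
  · rw [add_comm]
    congr 1
    · push_cast
      rw [sum_div]
      refine sum_congr rfl fun j _ => ?_
      rw [sum_div]
      refine sum_congr rfl fun C _ => ?_
      rw [mul_div_assoc, sum_div]
      congr 1
      exact sum_congr rfl fun r _ => by ring
    · rw [Int.cast_sum, sum_div]
      refine sum_congr rfl fun C _ => ?_
      rw [Int.cast_mul, mul_div_assoc]
      congr 1
      simp

end Main

theorem mainTheorem4 (n : ℕ) (hn : 1 ≤ n) (i : Fin (n - 1) → ℕ) (hi : ∀ j, 1 ≤ i j) :
    ∃ R : RatFunc ℚ, ∀ g : ℕ, 1 ≤ 4 * g + 2 * n - 2 - ∑ j, i j →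
      R.denom.eval (g : ℚ) ≠ 0 ∧
      normalizedRG g (appendLast i (4 * g + 2 * n - 2 - ∑ j, i j)) =
        R.eval (RingHom.id ℚ) (g : ℚ) := by
  obtain ⟨ℓ, hℓ⟩ : ∃ ℓ : Fin n, (ℓ : ℕ) = n - 1 := ⟨⟨n - 1, by omega⟩, rfl⟩
  have hsmall : ∑ j ∈ Finset.univ.erase ℓ, appendLast i 0 j = ∑ j, i j := by
    have h := sum_appendLast hn i 0
    rwa [← Finset.add_sum_erase _ _ (Finset.mem_univ ℓ), appendLast_last i 0 hℓ, zero_add,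
      add_zero] at h
  have hle : ∀ C ⊆ Finset.univ.erase ℓ, ∑ j ∈ C, appendLast i 0 j ≤ ∑ j, i j := fun C hC =>
    (Finset.sum_le_sum_of_subset hC).trans hsmall.le
  refine RationalOn.exists_ratFunc (s := genusDomain n (∑ j, i j)) (RationalOn.congr ?_
    fun g hg => normalizedRG_eq hn i hi hg hℓ)
  refine (RationalOn.const _).mul (RationalOn.sub ?_ (RationalOn.add ?_ ?_))
  · refine RationalOn.sum _ fun C hC => (RationalOn.const _).mul ((RationalOn.const _).mul ?_)
    have := hle C (Finset.mem_powerset.1 hC)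
    exact rationalOn_matchSum_ratio n _ (one_pow 2) _ (by omega)
  · refine RationalOn.sum _ fun j hj => RationalOn.sum _ fun C hC => (RationalOn.const _).mul
      (RationalOn.sum _ fun r hr => (RationalOn.const _).mul ((RationalOn.const _).mul ?_))
    have hC' := Finset.mem_powerset.1 hC
    have hjC : j ∉ C := fun h => by simpa using hC' h
    -- An arc at `j` has length `r` below the valency of `j`, which is not in `C`; so `r` plus the
    -- valencies in `C` stays below the fixed total, as the ratio lemma needs.
    have := hle (insert j C) (Finset.insert_subset hj (hC'.trans (Finset.erase_subset _ _)))
    rw [Finset.sum_insert hjC] at this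
    have := (Finset.mem_Ico.1 hr).2
    exact rationalOn_matchSum_ratio n _ (one_pow 2) _ (by omega)
  · exact RationalOn.sum _ fun C hC => (RationalOn.const _).mul
      (rationalOn_sum_arcs (hle C (Finset.mem_powerset.1 hC)))
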